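/- For all real constants $C_1,C_2,C_3$ there is a constant $K$, depending only on $C_1,C_2,C_3$, such that the following holds. Let $p$ be a prime, let $\mathbb{F}_{p^2}$ be a field with $p^2$ elements, with prime subfield $\mathbb{F}_p$, and let $t\in\mathbb{F}_{p^2}$ be a defining element over $\mathbb{F}_p$, that is, $\mathbb{F}_{p^2}=\mathbb{F}_p+t\,\mathbb{F}_p$. Let $P\subseteq\mathbb{F}_{p^2}\times\mathbb{F}_{p^2}$ with $|P|=n$, and let $A=\{x:(x,y)\in P\}$. Suppose that $|A|\le C_1p$ and that $A=\bigcup_{j\in J}A_j$, where $J\subseteq\mathbb{F}_p$ satisfies $$|J|\le C_2\max\{p^{1/2},\,n^{2560/6419}\},$$ and where, for each $j\in J$, $A_j\subseteq\mathbb{F}_p+jt$ and $$|A_j|\le C_3\max\{p^{1/2},\,n^{2560/6419}\}.$$ Then for every set $L$ of $n$ (affine) lines in $\mathbb{F}_{p^2}\times\mathbb{F}_{p^2}$, the number $I(P,L)=|\{(x,l)\in P\times L: x\in l\}|$ of incidences satisfies $$I(P,L)\le K\,n^{\frac32-\frac1{12838}}.$$ -/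

import Mathlib

/-- A line of the affine plane `F × F`: a one-dimensional affine subspace. Such a subspace is
automatically nonempty, and vertical lines are included. -/
def IsPlaneLine {F : Type*} [Field F] (l : AffineSubspace F (F × F)) : Prop :=
  Module.finrank F l.direction = 1

open Classical in
/-- The number `I(P, L)` of pairs `(x, l)` in `P × L` such that `x` lies on `l`. -/
noncomputable def incidences {F : Type*} [Field F] (P : Finset (F × F))
    (L : Finset (AffineSubspace F (F × F))) : ℕ :=
  ((P ×ˢ L).filter (fun z => z.1 ∈ z.2)).card

open Classical in
/-- The projection `{x : (x, y) ∈ P}` of a finite set of points to the first coordinate axis. -/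
noncomputable def xProj {F : Type*} (P : Finset (F × F)) : Finset F :=
  P.image Prod.fst

/-- The element `t` is a defining element of `F` over its prime subfield `F₀`:
`F = F₀ + t F₀`. Here `⊥ : Subfield F` is the prime subfield, which has `p` elements
when `F` is finite of characteristic `p`. -/
def IsDefiningElement {F : Type*} [Field F] (t : F) : Prop :=
  ∀ x : F, ∃ a ∈ (⊥ : Subfield F), ∃ b ∈ (⊥ : Subfield F), x = a + t * b

/-- The translate `F₀ + c` of the prime subfield `F₀` of `F`. -/
def primeTranslate {F : Type*} [Field F] (c : F) : Set F :=
  {x | ∃ a ∈ (⊥ : Subfield F), x = a + c}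

/-! Put n = q^12838 and suppose there are more than 16 q^19256 incidences. Dropping the points on at
least 2√n lines and pruning leaves a configuration in which every point and every line has degree at
least 2√n/q. Fix a nonvertical line l₀ in it and send l₀ to infinity by a projective map: the lines
through the point of l₀ with abscissa a become level sets of u - a w. So for at least √n/q
parameters a, the form u - a w takes at most 2√n values on a set of at least n/q² points
(`exists_mobius_mem_bot_of_incidences`).

With two of these forms as coordinates X, Y, the others are proportional to X + λY and take few
values along dense graphs. Balog–Szemerédi–Gowers, a pigeonhole over λ and Ruzsa's triangle
inequality give one set B, of size √n up to powers of q, such that B - lB is small for all l in a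
large set L (`exists_small_sub_smul`). By Plünnecke–Ruzsa and covering, the pivot sets of L are then
small as well (`card_pivotSet_le`).

Only few x make B + xB small. Let R be the set of ratios (a - b)/(c - d) over L
(`pivot_trichotomy`). If x is in R but x + 1 is not, the elements e + f(x + 1) are |L|² such
dilates, which is too many. Otherwise R is closed under x ↦ x + 1 and inversion, so either R has at
least p²/2 elements or R lies in the prime subfield; its size bounds p² or p by a power of q.

In the first case p is so small that |A| ≤ C₁p contradicts the number of abscissae on l₀. In the
second, a Möbius map takes many abscissae into the prime subfield. Three of them on one translate of
that subfield drag the whole translate along, and two whole translates do not fit; so there are at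
most 2|J| + max |A_j| of them (`card_le_of_mobius_mem_bot`), again too few. -/

/-! ### Collision and popularity counts -/

open Finset in
/-- Cauchy–Schwarz for the fibres of a map: few values force many collisions. -/
theorem card_sq_le_card_image_mul_card_collisions {α β : Type*} [DecidableEq α] [DecidableEq β]
    (s : Finset α) (f : α → β) :
    #s ^ 2 ≤ #(s.image f) * #{z ∈ s ×ˢ s | f z.1 = f z.2} := by
  have h1 : #s = ∑ b ∈ s.image f, #{a ∈ s | f a = b} :=
    card_eq_sum_card_fiberwise fun a ha => mem_image_of_mem f ha
  have h2 : #{z ∈ s ×ˢ s | f z.1 = f z.2} = ∑ b ∈ s.image f, #{a ∈ s | f a = b} ^ 2 := by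
    rw [card_eq_sum_card_fiberwise (f := fun z : α × α => f z.1) (t := s.image f)]
    · refine sum_congr rfl fun b _ => ?_
      rw [sq, ← card_product]
      congr 1
      ext ⟨x, y⟩
      simp only [mem_filter, mem_product]
      grind
    · intro z hz
      simp only [coe_filter, mem_product, Set.mem_ofPred_eq] at hz
      exact mem_image_of_mem f hz.1.1
  rw [h2, h1]
  exact sq_sum_le_card_mul_sum_sq

open Finset in
/-- If the values of `f` on `s` sum to at least `c + a * b`, where `#s ≤ b` and `f ≤ m`, then `f` is
at least `a` on many elements of `s`. -/
theorem le_card_filter_mul_of_le_sum {α : Type*} (s : Finset α) (f : α → ℝ) {a b c m : ℝ}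
    (ha : 0 ≤ a) (hs : (#s : ℝ) ≤ b) (hf : ∀ x ∈ s, f x ≤ m) (h : c + a * b ≤ ∑ x ∈ s, f x) :
    c ≤ #{x ∈ s | a ≤ f x} * m := by
  have h1 : ∑ x ∈ s, f x ≤ #{x ∈ s | a ≤ f x} * m + a * b := by
    rw [← sum_filter_add_sum_filter_not s (fun x => a ≤ f x)]
    refine add_le_add ?_ ?_
    · rw [← nsmul_eq_mul]
      exact sum_le_card_nsmul _ _ _ fun x hx => hf x (mem_filter.1 hx).1
    · calc ∑ x ∈ s with ¬a ≤ f x, f x ≤ #{x ∈ s | ¬a ≤ f x} • a :=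
            sum_le_card_nsmul _ _ _ fun x hx => (not_le.1 (mem_filter.1 hx).2).le
        _ ≤ a * b := by
            rw [nsmul_eq_mul, mul_comm]
            gcongr
            exact le_trans (by exact_mod_cast card_filter_le _ _) hs
  linarith

open Finset in
theorem sum_card_filter_mem_comm {α β : Type*} [DecidableEq α] [DecidableEq β] (X : Finset α)
    (Y : Finset β) (G : Finset (α × β)) :
    ∑ x ∈ X, (#{y ∈ Y | (x, y) ∈ G} : ℝ) = ∑ y ∈ Y, (#{x ∈ X | (x, y) ∈ G} : ℝ) := by
  exact_mod_cast sum_card_bipartiteAbove_eq_sum_card_bipartiteBelow (fun x y => (x, y) ∈ G)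

/-! ### Balog–Szemerédi–Gowers -/

open Finset in
/-- A dense bipartite graph contains a large set of vertices most pairs of which have many common
neighbours. -/
theorem exists_subset_few_bad_pairs {α β : Type*} [DecidableEq α] [DecidableEq β]
    (X : Finset α) (Y : Finset β) (G : Finset (α × β)) {M κ : ℝ} (hM : 0 < M) (hκ : 0 < κ)
    (hX : (#X : ℝ) ≤ M) (hY : (#Y : ℝ) ≤ M)
    (h : M ^ 2 / (2 * κ) ≤ ∑ x ∈ X, (#{y ∈ Y | (x, y) ∈ G} : ℝ)) :
    ∃ U ⊆ X, M ≤ 3 * κ * #U ∧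
      16 * κ * (#{z ∈ U ×ˢ U | (#{y ∈ Y | (z.1, y) ∈ G ∧ (z.2, y) ∈ G} : ℝ) <
        M / (128 * κ ^ 3)} : ℝ) ≤ (#U : ℝ) ^ 2 := by
  set bad : α × α → Prop := fun z =>
    (#{y ∈ Y | (z.1, y) ∈ G ∧ (z.2, y) ∈ G} : ℝ) < M / (128 * κ ^ 3) with hbad
  set N : β → Finset α := fun y => {x ∈ X | (x, y) ∈ G} with hN
  have hsum : M ^ 2 / (2 * κ) ≤ ∑ y ∈ Y, (#(N y) : ℝ) := by
    rw [sum_card_filter_mem_comm] at h; exact h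
  -- The sum of |N y|² counts pairs in X with a common neighbour y; Cauchy–Schwarz bounds it below,
  -- while a bad pair has few common neighbours and so contributes little.
  have hsq : M ^ 3 / (4 * κ ^ 2) ≤ ∑ y ∈ Y, (#(N y) : ℝ) ^ 2 := by
    have h1 : (M ^ 2 / (2 * κ)) ^ 2 ≤ M * ∑ y ∈ Y, (#(N y) : ℝ) ^ 2 :=
      calc (M ^ 2 / (2 * κ)) ^ 2 ≤ (∑ y ∈ Y, (#(N y) : ℝ)) ^ 2 := by gcongr
        _ ≤ #Y * ∑ y ∈ Y, (#(N y) : ℝ) ^ 2 := sq_sum_le_card_mul_sum_sq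
        _ ≤ _ := mul_le_mul_of_nonneg_right hY (sum_nonneg fun _ _ => sq_nonneg _)
    have h2 : (M ^ 2 / (2 * κ)) ^ 2 = M * (M ^ 3 / (4 * κ ^ 2)) := by
      field_simp; norm_num
    rw [h2] at h1
    exact le_of_mul_le_mul_left h1 hM
  have hbadsum : ∑ y ∈ Y, (#{z ∈ N y ×ˢ N y | bad z} : ℝ) ≤ M ^ 3 / (128 * κ ^ 3) := by
    have h1 : ∀ y ∈ Y, (#{z ∈ N y ×ˢ N y | bad z} : ℝ) =
        #{z ∈ {z ∈ X ×ˢ X | bad z} | (z.1, y) ∈ G ∧ (z.2, y) ∈ G} := by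
      intro y _
      congr 2
      ext z
      simp only [hN, mem_filter, mem_product]
      tauto
    rw [sum_congr rfl h1]
    have h2 := sum_card_bipartiteAbove_eq_sum_card_bipartiteBelow
      (s := {z ∈ X ×ˢ X | bad z}) (t := Y) (fun z y => (z.1, y) ∈ G ∧ (z.2, y) ∈ G)
    simp only [bipartiteAbove, bipartiteBelow] at h2
    have h3 : ∑ y ∈ Y, (#{z ∈ {z ∈ X ×ˢ X | bad z} | (z.1, y) ∈ G ∧ (z.2, y) ∈ G} : ℝ) =
        ∑ z ∈ X ×ˢ X with bad z, (#{y ∈ Y | (z.1, y) ∈ G ∧ (z.2, y) ∈ G} : ℝ) := by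
      exact_mod_cast h2.symm
    rw [h3]
    calc _ ≤ #{z ∈ X ×ˢ X | bad z} • (M / (128 * κ ^ 3)) :=
          sum_le_card_nsmul _ _ _ fun z hz => (mem_filter.1 hz).2.le
      _ ≤ M ^ 2 * (M / (128 * κ ^ 3)) := by
          rw [nsmul_eq_mul]
          gcongr
          calc (#{z ∈ X ×ˢ X | bad z} : ℝ) ≤ #(X ×ˢ X) := by exact_mod_cast card_filter_le _ _
            _ = #X * #X := by rw [card_product]; push_cast; ring
            _ ≤ M * M := by gcongr
            _ = M ^ 2 := by ring
      _ = _ := by ring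
  -- Averaging the difference gives both conclusions at once: being at least M²/(8κ²), it makes N y
  -- large, and being nonnegative, it makes the bad pairs rare.
  have hex : ∃ y ∈ Y, M ^ 2 / (8 * κ ^ 2) ≤
      (#(N y) : ℝ) ^ 2 - 16 * κ * (#{z ∈ N y ×ˢ N y | bad z} : ℝ) := by
    by_contra! hcon
    have hYne : Y.Nonempty := by
      rw [nonempty_iff_ne_empty]
      rintro rfl
      simp only [sum_empty] at hsum
      have : 0 < M ^ 2 / (2 * κ) := by positivity
      linarith
    have h1 := sum_lt_sum_of_nonempty hYne hcon
    rw [sum_sub_distrib, ← mul_sum, sum_const, nsmul_eq_mul] at h1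
    have h2 : (#Y : ℝ) * (M ^ 2 / (8 * κ ^ 2)) ≤ M * (M ^ 2 / (8 * κ ^ 2)) := by gcongr
    have h3 : 16 * κ * ∑ y ∈ Y, (#{z ∈ N y ×ˢ N y | bad z} : ℝ) ≤
        16 * κ * (M ^ 3 / (128 * κ ^ 3)) := by gcongr
    have h4 : 16 * κ * (M ^ 3 / (128 * κ ^ 3)) + M * (M ^ 2 / (8 * κ ^ 2)) =
        M ^ 3 / (4 * κ ^ 2) := by
      field_simp; norm_num
    linarith
  obtain ⟨y, -, hy⟩ := hex
  refine ⟨N y, filter_subset _ _, ?_, ?_⟩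
  · have h1 : M ^ 2 / (8 * κ ^ 2) ≤ (#(N y) : ℝ) ^ 2 := by
      have : 0 ≤ 16 * κ * (#{z ∈ N y ×ˢ N y | bad z} : ℝ) := by positivity
      linarith
    rw [div_le_iff₀ (by positivity)] at h1
    refine le_of_sq_le_sq ?_ (by positivity)
    nlinarith [sq_nonneg (κ * (#(N y) : ℝ))]
  · have : 0 ≤ M ^ 2 / (8 * κ ^ 2) := by positivity
    linarith

open Finset in
/-- **Balog–Szemerédi–Gowers, graph form.** A bipartite graph of density `1 / κ` contains large sets
of vertices on both sides any two elements of which are joined by many paths of length three. -/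
theorem exists_subsets_many_paths {α β : Type*} [DecidableEq α] [DecidableEq β]
    (X : Finset α) (Y : Finset β) (G : Finset (α × β)) (hG : G ⊆ X ×ˢ Y) {M κ : ℝ} (hM : 0 < M)
    (hκ : 0 < κ) (hX : (#X : ℝ) ≤ M) (hY : (#Y : ℝ) ≤ M) (h : M ^ 2 / κ ≤ #G) :
    ∃ X' ⊆ X, ∃ Y' ⊆ Y, M ≤ 8 * κ * #X' ∧ M ≤ 8 * κ * #Y' ∧ ∀ x ∈ X', ∀ y ∈ Y',
      M ^ 2 ≤ 2 ^ 12 * κ ^ 5 *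
        #{z ∈ Y ×ˢ X | (x, z.1) ∈ G ∧ (z.2, z.1) ∈ G ∧ (z.2, y) ∈ G} := by
  have hGsum : (#G : ℝ) = ∑ x ∈ X, (#{y ∈ Y | (x, y) ∈ G} : ℝ) := by
    have : #G = ∑ x ∈ X, #{y ∈ Y | (x, y) ∈ G} := by
      rw [card_eq_sum_card_fiberwise (f := Prod.fst) (t := X)
        fun z hz => (mem_product.1 (hG hz)).1]
      refine sum_congr rfl fun x hx => ?_
      refine card_bij' (fun z _ => z.2) (fun y _ => (x, y)) ?_ ?_ ?_ ?_
      · rintro ⟨a, b⟩ hz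
        have := hG (mem_filter.1 hz).1
        simp only [mem_filter, mem_product] at *
        grind
      · intro y hy
        simp only [mem_filter] at *
        grind
      · rintro ⟨a, b⟩ hz
        simp only [mem_filter] at hz
        grind
      · intro y hy; rfl
    exact_mod_cast this
  -- Deleting the vertices of degree below M/(2κ) costs at most half of the M²/κ edges.
  set X₁ : Finset α := {x ∈ X | M / (2 * κ) ≤ (#{y ∈ Y | (x, y) ∈ G} : ℝ)} with hX₁
  have hX₁sum : M ^ 2 / (2 * κ) ≤ ∑ x ∈ X₁, (#{y ∈ Y | (x, y) ∈ G} : ℝ) := by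
    have h1 := sum_filter_add_sum_filter_not X
      (fun x => M / (2 * κ) ≤ (#{y ∈ Y | (x, y) ∈ G} : ℝ))
      (fun x => (#{y ∈ Y | (x, y) ∈ G} : ℝ))
    have h2 : ∑ x ∈ X with ¬M / (2 * κ) ≤ (#{y ∈ Y | (x, y) ∈ G} : ℝ),
        (#{y ∈ Y | (x, y) ∈ G} : ℝ) ≤ M * (M / (2 * κ)) := by
      refine (sum_le_card_nsmul _ _ _ fun x hx => (not_le.1 (mem_filter.1 hx).2).le).trans ?_
      rw [nsmul_eq_mul]
      gcongr
      exact le_trans (by exact_mod_cast card_filter_le _ _) hX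
    have h3 : M ^ 2 / κ - M * (M / (2 * κ)) = M ^ 2 / (2 * κ) := by field_simp; norm_num
    linarith
  obtain ⟨U, hU, hUcard, hUbad⟩ := exists_subset_few_bad_pairs X₁ Y G hM hκ
    (le_trans (by exact_mod_cast card_filter_le _ _) hX) hY hX₁sum
  set bad : α × α → Prop := fun z =>
    (#{y ∈ Y | (z.1, y) ∈ G ∧ (z.2, y) ∈ G} : ℝ) < M / (128 * κ ^ 3) with hbad
  have hUpos : (0 : ℝ) < #U := by
    by_contra hcon
    have : (#U : ℝ) = 0 := le_antisymm (not_lt.1 hcon) (by positivity)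
    rw [this] at hUcard
    linarith
  -- X' drops the vertices in too many bad pairs, at most half of U. Y' keeps the vertices with many
  -- neighbours in U. The threshold 1/(4κ) is twice 1/(8κ), so that good neighbours remain below.
  set X' : Finset α := {u ∈ U | ¬(#U : ℝ) / (8 * κ) ≤ (#{v ∈ U | bad (u, v)} : ℝ)} with hX'
  set Y' : Finset β := {y ∈ Y | (#U : ℝ) / (4 * κ) ≤ (#{u ∈ U | (u, y) ∈ G} : ℝ)} with hY'
  have hX'card : (#U : ℝ) ≤ 2 * #X' := by
    have h1 : (#{u ∈ U | (#U : ℝ) / (8 * κ) ≤ (#{v ∈ U | bad (u, v)} : ℝ)} : ℝ) + #X' = #U := by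
      exact_mod_cast card_filter_add_card_filter_not
        (fun u => (#U : ℝ) / (8 * κ) ≤ (#{v ∈ U | bad (u, v)} : ℝ))
    have h2 : (#{u ∈ U | (#U : ℝ) / (8 * κ) ≤ (#{v ∈ U | bad (u, v)} : ℝ)} : ℝ) *
        (#U / (8 * κ)) ≤ (#{z ∈ U ×ˢ U | bad z} : ℝ) := by
      have h3 : (#{z ∈ U ×ˢ U | bad z} : ℝ) = ∑ u ∈ U, (#{v ∈ U | bad (u, v)} : ℝ) := by
        simp only [card_filter, sum_product]
        push_cast
        rfl
      rw [h3, ← nsmul_eq_mul]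
      refine (card_nsmul_le_sum _ (fun u => (#{v ∈ U | bad (u, v)} : ℝ)) _
        fun u hu => (mem_filter.1 hu).2).trans ?_
      exact sum_le_sum_of_subset_of_nonneg (filter_subset _ _) fun _ _ _ => by positivity
    have h4 : (#{u ∈ U | (#U : ℝ) / (8 * κ) ≤ (#{v ∈ U | bad (u, v)} : ℝ)} : ℝ) * 2 * #U ≤
        #U * #U := by
      have h5 := mul_le_mul_of_nonneg_left h2 (by positivity : 0 ≤ 16 * κ)
      have h6 : 16 * κ * ((#{u ∈ U | (#U : ℝ) / (8 * κ) ≤ (#{v ∈ U | bad (u, v)} : ℝ)} : ℝ) *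
        (#U / (8 * κ))) = (#{u ∈ U | (#U : ℝ) / (8 * κ) ≤ (#{v ∈ U | bad (u, v)} : ℝ)} : ℝ)
          * 2 * #U := by
        generalize (#{u ∈ U | (#U : ℝ) / (8 * κ) ≤ (#{v ∈ U | bad (u, v)} : ℝ)} : ℝ) = r
        field_simp; ring
      rw [h6] at h5
      nlinarith
    have h7 := le_of_mul_le_mul_right h4 hUpos
    linarith
  have hY'card : M ≤ 4 * κ * #Y' := by
    have h1 : (#U : ℝ) * (M / (2 * κ)) ≤ ∑ y ∈ Y, (#{u ∈ U | (u, y) ∈ G} : ℝ) := by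
      rw [← sum_card_filter_mem_comm, ← nsmul_eq_mul]
      exact card_nsmul_le_sum _ _ _ fun u hu => (mem_filter.1 (hU hu)).2
    have h2 := le_card_filter_mul_of_le_sum Y (fun y => (#{u ∈ U | (u, y) ∈ G} : ℝ))
      (a := #U / (4 * κ)) (b := M) (c := #U * (M / (4 * κ))) (m := #U) (by positivity) hY
      (fun y _ => by exact_mod_cast card_filter_le _ _)
      (le_trans (le_of_eq (by field_simp; norm_num)) h1)
    rw [mul_comm] at h2
    have h3 := le_of_mul_le_mul_right h2 hUpos
    rw [div_le_iff₀ (by positivity)] at h3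
    linarith
  refine ⟨X', (filter_subset _ _).trans (hU.trans (filter_subset _ _)), Y', filter_subset _ _,
    ?_, ?_, ?_⟩
  · nlinarith
  · have : 0 ≤ κ * (#Y' : ℝ) := by positivity
    linarith
  intro x hx y hy
  simp only [hX', hY', mem_filter, not_le] at hx hy
  -- Each u in V is a neighbour of y sharing many neighbours b with x, which gives paths x – b – u –
  -- y.
  set V : Finset α := {u ∈ U | (u, y) ∈ G ∧ ¬bad (x, u)} with hV
  have hVcard : (#U : ℝ) / (8 * κ) ≤ #V := by
    have h1 : #{u ∈ U | (u, y) ∈ G} ≤ #V + #{v ∈ U | bad (x, v)} := by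
      refine (card_le_card ?_).trans (card_union_le _ _)
      intro u hu
      simp only [hV, mem_union, mem_filter] at *
      tauto
    have h2 : (#{u ∈ U | (u, y) ∈ G} : ℝ) ≤ #V + #{v ∈ U | bad (x, v)} := by exact_mod_cast h1
    have h3 : (#U : ℝ) / (4 * κ) = #U / (8 * κ) + #U / (8 * κ) := by field_simp; norm_num
    linarith [hx.2, hy.2]
  have hpaths : (#V : ℝ) * (M / (128 * κ ^ 3)) ≤
      #{z ∈ Y ×ˢ X | (x, z.1) ∈ G ∧ (z.2, z.1) ∈ G ∧ (z.2, y) ∈ G} := by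
    have h1 : (∑ u ∈ V, #{b ∈ Y | (x, b) ∈ G ∧ (u, b) ∈ G}) ≤
        #{z ∈ Y ×ˢ X | (x, z.1) ∈ G ∧ (z.2, z.1) ∈ G ∧ (z.2, y) ∈ G} := by
      rw [← card_sigma]
      refine card_le_card_of_injOn (fun z => (z.2, z.1)) ?_ ?_
      · rintro ⟨u, b⟩ hz
        have hz' := mem_sigma.1 hz
        simp only [hV, mem_filter] at hz'
        have hu : u ∈ X := (mem_filter.1 (hU hz'.1.1)).1
        simp only [coe_filter, mem_product, Set.mem_ofPred_eq]
        tauto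
      · rintro ⟨u, b⟩ _ ⟨u', b'⟩ _ hz
        simp only [Prod.mk.injEq] at hz
        obtain ⟨rfl, rfl⟩ := hz
        rfl
    have h2 : (#V : ℝ) * (M / (128 * κ ^ 3)) ≤
        ∑ u ∈ V, (#{b ∈ Y | (x, b) ∈ G ∧ (u, b) ∈ G} : ℝ) := by
      rw [← nsmul_eq_mul]
      exact card_nsmul_le_sum _ _ _ fun u hu => not_lt.1 (mem_filter.1 hu).2.2
    exact h2.trans (by exact_mod_cast h1)
  have h5 : (M / (3 * κ)) / (8 * κ) * (M / (128 * κ ^ 3)) ≤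
      #{z ∈ Y ×ˢ X | (x, z.1) ∈ G ∧ (z.2, z.1) ∈ G ∧ (z.2, y) ∈ G} := by
    refine le_trans ?_ hpaths
    gcongr
    refine le_trans ?_ hVcard
    gcongr
    rw [div_le_iff₀ (by positivity)]
    linarith
  have h6 : (M / (3 * κ)) / (8 * κ) * (M / (128 * κ ^ 3)) = M ^ 2 / (3072 * κ ^ 5) := by
    field_simp; norm_num
  rw [h6, div_le_iff₀ (by positivity)] at h5
  refine h5.trans ?_
  rw [mul_comm]
  gcongr
  norm_num

open Finset Pointwise in
/-- **Balog–Szemerédi–Gowers.** If the sums along a dense graph take few values, then large subsets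
of both sides have a small sumset. -/
theorem exists_subsets_card_add_le {A : Type*} [AddCommGroup A] [DecidableEq A]
    (X Y : Finset A) (G : Finset (A × A)) (hG : G ⊆ X ×ˢ Y) {M κ : ℝ} (hM : 0 < M)
    (hκ : 0 < κ) (hX : (#X : ℝ) ≤ M) (hY : (#Y : ℝ) ≤ M) (h : M ^ 2 / κ ≤ #G)
    (hsum : (#(G.image fun z => z.1 + z.2) : ℝ) ≤ M) :
    ∃ X' ⊆ X, ∃ Y' ⊆ Y, M ≤ 8 * κ * #X' ∧ M ≤ 8 * κ * #Y' ∧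
      (#(X' + Y') : ℝ) ≤ 2 ^ 12 * κ ^ 5 * M := by
  obtain ⟨X', hX', Y', hY', hX'c, hY'c, hpath⟩ := exists_subsets_many_paths X Y G hG hM hκ hX hY h
  refine ⟨X', hX', Y', hY', hX'c, hY'c, ?_⟩
  set S := G.image fun z => z.1 + z.2 with hS
  have hrep : ∀ z ∈ X' + Y', ∃ x ∈ X', ∃ y ∈ Y', x + y = z := fun z hz => mem_add.1 hz
  choose! f hf g hg hfg using hrep
  set Q : A → Finset (A × A) := fun z =>
    {w ∈ Y ×ˢ X | (f z, w.1) ∈ G ∧ (w.2, w.1) ∈ G ∧ (w.2, g z) ∈ G} with hQ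
  -- For a path x – b – u – y, x + y = (x + b) - (u + b) + (u + y). The three sums along edges thus
  -- determine z, and then b and u since the representation of z is fixed.
  have h1 : ∑ z ∈ X' + Y', #(Q z) ≤ #(S ×ˢ S ×ˢ S) := by
    rw [← card_sigma]
    refine card_le_card_of_injOn
      (fun w => (f w.1 + w.2.1, w.2.2 + w.2.1, w.2.2 + g w.1)) ?_ ?_
    · rintro ⟨z, w⟩ hz
      have hz' := mem_sigma.1 hz
      simp only [hQ, mem_filter] at hz'
      simp only [coe_product, Set.mem_prod, mem_coe, hS]
      exact ⟨mem_image.2 ⟨_, hz'.2.2.1, rfl⟩, mem_image.2 ⟨_, hz'.2.2.2.1, rfl⟩,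
        mem_image.2 ⟨_, hz'.2.2.2.2, rfl⟩⟩
    · rintro ⟨z, y, x⟩ hz ⟨z', y', x'⟩ hz' heq
      have hz1 := (mem_sigma.1 hz).1
      have hz1' := (mem_sigma.1 hz').1
      simp only [Prod.mk.injEq] at heq
      obtain ⟨h1, h2, h3⟩ := heq
      have e : z = z' := by
        calc z = f z + g z := (hfg z hz1).symm
          _ = (f z + y) - (x + y) + (x + g z) := by abel
          _ = (f z' + y') - (x' + y') + (x' + g z') := by rw [h1, h2, h3]
          _ = f z' + g z' := by abel
          _ = z' := hfg z' hz1'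
      subst e
      rw [add_left_cancel h1, add_right_cancel h3]
  have h2 : (#(X' + Y') : ℝ) * M ^ 2 ≤ 2 ^ 12 * κ ^ 5 * ∑ z ∈ X' + Y', (#(Q z) : ℝ) := by
    rw [← nsmul_eq_mul, mul_sum]
    exact card_nsmul_le_sum _ _ _ fun z hz => hpath _ (hf z hz) _ (hg z hz)
  have h3 : (∑ z ∈ X' + Y', (#(Q z) : ℝ)) ≤ M ^ 3 := by
    calc (∑ z ∈ X' + Y', (#(Q z) : ℝ)) ≤ #(S ×ˢ S ×ˢ S) := by exact_mod_cast h1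
      _ = (#S : ℝ) ^ 3 := by simp only [card_product]; push_cast; ring
      _ ≤ M ^ 3 := by gcongr
  have h4 : (#(X' + Y') : ℝ) * M ^ 2 ≤ (2 ^ 12 * κ ^ 5 * M) * M ^ 2 :=
    calc (#(X' + Y') : ℝ) * M ^ 2 ≤ 2 ^ 12 * κ ^ 5 * ∑ z ∈ X' + Y', (#(Q z) : ℝ) := h2
      _ ≤ 2 ^ 12 * κ ^ 5 * M ^ 3 := by gcongr
      _ = _ := by ring
  exact le_of_mul_le_mul_right h4 (by positivity)

/-! ### One set with small differences from many of its dilates -/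

open Finset in
/-- Among dense subsets of a finite set, one of them meets many of the others in a dense set. -/
theorem exists_many_large_inter {ι α : Type*} [DecidableEq α] {I : Finset ι}
    (hI : I.Nonempty) (S : ι → Finset α) (T : Finset α) {N ρ : ℝ} (hN : 0 < N) (hρ : 0 ≤ ρ)
    (hT : (#T : ℝ) ≤ N) (hS : ∀ i ∈ I, S i ⊆ T) (hcard : ∀ i ∈ I, ρ * N ≤ #(S i)) :
    ∃ j ∈ I, ρ ^ 2 * #I ≤ 2 * #{i ∈ I | ρ ^ 2 * N / 2 ≤ (#(S i ∩ S j) : ℝ)} := by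
  have h1 : ∑ i ∈ I, (#(S i) : ℝ) = ∑ p ∈ T, (#{i ∈ I | p ∈ S i} : ℝ) := by
    have := sum_card_bipartiteAbove_eq_sum_card_bipartiteBelow (s := I) (t := T)
      (fun i p => p ∈ S i)
    simp only [bipartiteAbove, bipartiteBelow] at this
    rw [sum_congr rfl (fun i hi => by
      rw [filter_mem_eq_inter, inter_eq_right.2 (hS i hi)])] at this
    exact_mod_cast this
  have h2 : ∑ j ∈ I, ∑ i ∈ I, (#(S i ∩ S j) : ℝ) = ∑ p ∈ T, (#{i ∈ I | p ∈ S i} : ℝ) ^ 2 := by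
    rw [← sum_product']
    have := sum_card_bipartiteAbove_eq_sum_card_bipartiteBelow (s := I ×ˢ I) (t := T)
      (fun z p => p ∈ S z.2 ∩ S z.1)
    simp only [bipartiteAbove, bipartiteBelow] at this
    rw [sum_congr rfl (fun z hz => by
      rw [filter_mem_eq_inter, inter_eq_right.2 (inter_subset_left.trans
        (hS _ (mem_product.1 hz).2))])] at this
    have h3 : ∀ p ∈ T, #{z ∈ I ×ˢ I | p ∈ S z.2 ∩ S z.1} = #{i ∈ I | p ∈ S i} ^ 2 := by
      intro p _
      rw [sq, ← card_product]
      congr 1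
      ext ⟨a, b⟩
      simp only [mem_filter, mem_product, mem_inter]
      tauto
    rw [sum_congr rfl h3] at this
    exact_mod_cast this
  -- Cauchy–Schwarz over the points of T: two members of the family meet in ρ²N points on average.
  have h3 : (ρ ^ 2 * N * #I) * #I ≤ ∑ j ∈ I, ∑ i ∈ I, (#(S i ∩ S j) : ℝ) := by
    have h4 : ρ * N * #I ≤ ∑ i ∈ I, (#(S i) : ℝ) := by
      rw [mul_comm, ← nsmul_eq_mul]
      exact card_nsmul_le_sum _ _ _ hcard
    have h5 : (ρ * N * #I) ^ 2 ≤ N * ∑ p ∈ T, (#{i ∈ I | p ∈ S i} : ℝ) ^ 2 :=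
      calc (ρ * N * #I) ^ 2 ≤ (∑ i ∈ I, (#(S i) : ℝ)) ^ 2 := by gcongr
        _ = (∑ p ∈ T, (#{i ∈ I | p ∈ S i} : ℝ)) ^ 2 := by rw [h1]
        _ ≤ #T * ∑ p ∈ T, (#{i ∈ I | p ∈ S i} : ℝ) ^ 2 := sq_sum_le_card_mul_sum_sq
        _ ≤ _ := mul_le_mul_of_nonneg_right hT (sum_nonneg fun _ _ => sq_nonneg _)
    rw [h2]
    refine le_of_mul_le_mul_left (le_trans (le_of_eq ?_) h5) hN
    ring
  obtain ⟨j, hj, hj'⟩ : ∃ j ∈ I, ρ ^ 2 * N * #I ≤ ∑ i ∈ I, (#(S i ∩ S j) : ℝ) := by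
    by_contra! hcon
    have := sum_lt_sum_of_nonempty hI hcon
    rw [sum_const, nsmul_eq_mul] at this
    linarith
  refine ⟨j, hj, ?_⟩
  have h6 := le_card_filter_mul_of_le_sum I (fun i => (#(S i ∩ S j) : ℝ))
    (a := ρ ^ 2 * N / 2) (b := #I) (c := ρ ^ 2 * #I / 2 * N) (m := N) (by positivity) le_rfl
    (fun i hi => le_trans (by exact_mod_cast card_le_card (inter_subset_left.trans (hS i hi))) hT)
    (le_trans (le_of_eq (by ring)) hj')
  have h7 := le_of_mul_le_mul_right h6 hN
  linarith

open Pointwise in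
theorem Finset.smul_finset_sub_distrib {F : Type*} [Field F] [DecidableEq F] (a : F)
    (A B : Finset F) : a • (A - B) = a • A - a • B :=
  Finset.image_image₂_distrib fun x y => smul_sub a x y

open Finset Pointwise in
/-- If `X` and the dilates `l • Y` have few sums along dense graphs, then a large subset `B` of `X`
has small doubling and small difference sets with many of its dilates. -/
theorem exists_small_sub_smul {F : Type*} [Field F] [DecidableEq F]
    (X Y : Finset F) (D : Finset F) (hDne : D.Nonempty) (hD : ∀ l ∈ D, l ≠ 0)
    (G : F → Finset (F × F)) (hG : ∀ l ∈ D, G l ⊆ X ×ˢ Y) {M κ : ℝ} (hM : 0 < M) (hκ : 0 < κ)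
    (hX : (#X : ℝ) ≤ M) (hY : (#Y : ℝ) ≤ M) (h : ∀ l ∈ D, M ^ 2 / κ ≤ #(G l))
    (hsum : ∀ l ∈ D, (#((G l).image fun z => z.1 + l * z.2) : ℝ) ≤ M) :
    ∃ B ⊆ X, ∃ l₀ ∈ D, ∃ D' ⊆ D, M ≤ 8 * κ * #B ∧ (#D : ℝ) ≤ 2 * (8 * κ) ^ 4 * #D' ∧
      (#(B - B) : ℝ) ≤ 2 ^ 30 * κ ^ 12 * #B ∧
      ∀ l ∈ D', (#(B - (l / l₀) • B) : ℝ) ≤ 2 ^ 67 * κ ^ 26 * #B := by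
  have key : ∀ l ∈ D, ∃ X' ⊆ X, ∃ Y' ⊆ Y, M ≤ 8 * κ * #X' ∧ M ≤ 8 * κ * #Y' ∧
      (#(X' + l • Y') : ℝ) ≤ 2 ^ 12 * κ ^ 5 * M := by
    intro l hl
    have hl0 := hD l hl
    obtain ⟨X', hX', Y', hY', h1, h2, h3⟩ := exists_subsets_card_add_le X (l • Y)
      ((G l).image fun z => (z.1, l * z.2)) (by
        rintro z hz
        obtain ⟨w, hw, rfl⟩ := mem_image.1 hz
        have := mem_product.1 (hG l hl hw)
        exact mem_product.2 ⟨this.1, smul_mem_smul_finset this.2⟩)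
      hM hκ hX (by rwa [card_smul_finset₀ hl0]) (by
        rw [card_image_of_injective]
        · exact h l hl
        · rintro ⟨a, b⟩ ⟨c, d⟩ hab
          simp only [Prod.mk.injEq, mul_eq_mul_left_iff, hl0, or_false] at hab
          rw [hab.1, hab.2]) (by
        rw [image_image]
        exact hsum l hl)
    refine ⟨X', hX', l⁻¹ • Y', ?_, h1, ?_, ?_⟩
    · intro y hy
      obtain ⟨z, hz, rfl⟩ := mem_smul_finset.1 hy
      obtain ⟨w, hw, rfl⟩ := mem_smul_finset.1 (hY' hz)
      simpa [smul_smul, hl0] using hw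
    · rwa [card_smul_finset₀ (inv_ne_zero hl0)]
    · rwa [smul_smul, mul_inv_cancel₀ hl0, one_smul]
  choose! X' hX' Y' hY' hX'c hY'c hadd using key
  -- The sets X' l, Y' l depend on l. Overlaps of the products X' l × Y' l inside X × Y single out
  -- one l₀ whose sets serve for many l.
  obtain ⟨l₀, hl₀, hmany⟩ := exists_many_large_inter hDne (fun l => X' l ×ˢ Y' l) (X ×ˢ Y)
    (N := M ^ 2) (ρ := 1 / (8 * κ) ^ 2) (by positivity) (by positivity)
    (by rw [card_product]; push_cast; nlinarith [(Nat.cast_nonneg #X : (0 : ℝ) ≤ #X),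
          (Nat.cast_nonneg #Y : (0 : ℝ) ≤ #Y)])
    (fun l hl => product_subset_product (hX' l hl) (hY' l hl))
    (fun l hl => by
      rw [card_product]
      push_cast
      rw [div_mul_eq_mul_div, one_mul, div_le_iff₀ (by positivity)]
      calc M ^ 2 = M * M := sq M
        _ ≤ (8 * κ * #(X' l)) * (8 * κ * #(Y' l)) := by
            gcongr
            · exact hX'c l hl
            · exact hY'c l hl
        _ = _ := by ring)
  set D' := {l ∈ D | (1 / (8 * κ) ^ 2) ^ 2 * M ^ 2 / 2 ≤
    (#(X' l ×ˢ Y' l ∩ X' l₀ ×ˢ Y' l₀) : ℝ)} with hD'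
  set B := X' l₀ with hB
  have hBc := hX'c l₀ hl₀
  have hBpos : (0 : ℝ) < #B := by
    by_contra hcon
    have : (#B : ℝ) = 0 := le_antisymm (not_lt.1 hcon) (by positivity)
    rw [this] at hBc
    linarith
  have hYpos : (0 : ℝ) < #(Y' l₀) := by
    by_contra hcon
    have h0 : (#(Y' l₀) : ℝ) = 0 := le_antisymm (not_lt.1 hcon) (by positivity)
    have := hY'c l₀ hl₀
    rw [h0] at this
    linarith
  have hl₀0 := hD l₀ hl₀
  set s := 8 * κ with hs
  set β := 2 ^ 12 * κ ^ 5 with hβ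
  have hspos : 0 < s := by positivity
  have hβpos : 0 < β := by positivity
  have hsub : (#(B - B) : ℝ) ≤ s * β ^ 2 * M := by
    have h1 : (#(B - B) : ℝ) * #(l₀ • Y' l₀) ≤ #(B + l₀ • Y' l₀) * #(B + l₀ • Y' l₀) := by
      exact_mod_cast ruzsa_triangle_inequality_sub_add_add B (l₀ • Y' l₀) B
    rw [card_smul_finset₀ hl₀0] at h1
    have h2 := hadd l₀ hl₀
    have h3 := hY'c l₀ hl₀
    refine le_of_mul_le_mul_right (?_ : _ * M ≤ _ * M) hM
    calc (#(B - B) : ℝ) * M ≤ #(B - B) * (s * #(Y' l₀)) := by gcongr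
      _ = s * (#(B - B) * #(Y' l₀)) := by ring
      _ ≤ s * ((β * M) * (β * M)) := by
          refine mul_le_mul_of_nonneg_left (h1.trans ?_) hspos.le
          exact mul_le_mul h2 h2 (by positivity) (by positivity)
      _ = _ := by ring
  refine ⟨B, hX' l₀ hl₀, l₀, hl₀, D', filter_subset _ _, hBc, ?_, ?_, ?_⟩
  · have h1 : (1 / s ^ 2) ^ 2 * (#D : ℝ) = #D / s ^ 4 := by ring
    rw [h1, div_le_iff₀ (by positivity)] at hmany
    linarith
  · calc (#(B - B) : ℝ) ≤ s * β ^ 2 * M := hsub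
      _ ≤ s * β ^ 2 * (s * #B) := by gcongr
      _ = _ := by rw [hs, hβ]; ring
  · intro l hl
    obtain ⟨hlD, hlc⟩ := mem_filter.1 hl
    have hl0 := hD l hlD
    rw [product_inter_product, card_product] at hlc
    push_cast at hlc
    -- Two uses of Ruzsa's triangle inequality: B + l Y₁ is bounded through X₁, and (l/l₀) B + l Y₁
    -- is a dilate of a subset of B + l₀ Y' l₀, so eliminating l Y₁ compares B with (l/l₀) B.
    set X₁ := X' l ∩ B with hX₁
    set Y₁ := Y' l ∩ Y' l₀ with hY₁
    have e1 : M ^ 2 ≤ 2 * s ^ 4 * (#X₁ * #Y₁) := by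
      have h1 : (1 / s ^ 2) ^ 2 * M ^ 2 / 2 = M ^ 2 / (2 * s ^ 4) := by ring
      rw [h1, div_le_iff₀ (by positivity)] at hlc
      linarith
    have e2 : (#(X₁ + l • Y₁) : ℝ) ≤ β * M := by
      have h1 : #(X₁ + l • Y₁) ≤ #(X' l + l • Y' l) := card_le_card
        (add_subset_add inter_subset_left (smul_finset_subset_smul_finset inter_subset_left))
      exact (Nat.cast_le.2 h1).trans (hadd l hlD)
    have e3 : (#X₁ : ℝ) * #(B + l • Y₁) ≤ s * β ^ 2 * M * (β * M) := by
      have h1 : (#X₁ : ℝ) * #(B + l • Y₁) ≤ #(X₁ - B) * #(X₁ + l • Y₁) := by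
        exact_mod_cast ruzsa_triangle_inequality_add_sub_add B X₁ (l • Y₁)
      have h2 : (#(X₁ - B) : ℝ) ≤ #(B - B) := by
        exact_mod_cast card_le_card (sub_subset_sub inter_subset_right Subset.rfl)
      refine h1.trans ?_
      gcongr
      exact h2.trans hsub
    have e4 : (#((l / l₀) • B + l • Y₁) : ℝ) ≤ β * M := by
      have h1 : (l / l₀) • B + l • Y₁ = (l / l₀) • (B + l₀ • Y₁) := by
        rw [smul_add, smul_smul, div_mul_cancel₀ _ hl₀0]
      rw [h1, card_smul_finset₀ (div_ne_zero hl0 hl₀0)]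
      have h2 : #(B + l₀ • Y₁) ≤ #(B + l₀ • Y' l₀) := card_le_card
        (add_subset_add_left (smul_finset_subset_smul_finset inter_subset_right))
      exact (Nat.cast_le.2 h2).trans (hadd l₀ hl₀)
    have e5 : (#(B - (l / l₀) • B) : ℝ) * #Y₁ ≤ #(B + l • Y₁) * (β * M) := by
      have h1 : (#(B - (l / l₀) • B) : ℝ) * #(l • Y₁) ≤
          #(B + l • Y₁) * #((l / l₀) • B + l • Y₁) := by
        exact_mod_cast ruzsa_triangle_inequality_sub_add_add B (l • Y₁) ((l / l₀) • B)
      rw [card_smul_finset₀ hl0] at h1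
      exact h1.trans (by gcongr)
    have e6 : (#(B - (l / l₀) • B) : ℝ) * M ^ 2 ≤ (2 * s ^ 5 * β ^ 4 * M) * M ^ 2 :=
      calc (#(B - (l / l₀) • B) : ℝ) * M ^ 2
          ≤ #(B - (l / l₀) • B) * (2 * s ^ 4 * (#X₁ * #Y₁)) := by gcongr
        _ = 2 * s ^ 4 * #X₁ * (#(B - (l / l₀) • B) * #Y₁) := by ring
        _ ≤ 2 * s ^ 4 * #X₁ * (#(B + l • Y₁) * (β * M)) := by gcongr
        _ = 2 * s ^ 4 * (β * M) * (#X₁ * #(B + l • Y₁)) := by ring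
        _ ≤ 2 * s ^ 4 * (β * M) * (s * β ^ 2 * M * (β * M)) := by gcongr
        _ = _ := by ring
    calc (#(B - (l / l₀) • B) : ℝ) ≤ 2 * s ^ 5 * β ^ 4 * M :=
          le_of_mul_le_mul_right e6 (by positivity)
      _ ≤ 2 * s ^ 5 * β ^ 4 * (s * #B) := by gcongr
      _ = _ := by rw [hs, hβ]; ring

/-! ### Covering calculus and pivot sets -/

open Finset Pointwise in
/-- `S` is covered by at most `h` translates of `m • B - m • B`. -/
def CoveredBy {A : Type*} [AddCommGroup A] [DecidableEq A] (B S : Finset A) (h : ℝ) (m : ℕ) :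
    Prop :=
  ∃ Z : Finset A, (#Z : ℝ) ≤ h ∧ S ⊆ Z + (m • B - m • B)

namespace CoveredBy

open Finset Pointwise

section Group

variable {A : Type*} [AddCommGroup A] [DecidableEq A] {B S S₁ S₂ : Finset A} {h h₁ h₂ τ : ℝ}
  {m m₁ m₂ : ℕ}

theorem add (H₁ : CoveredBy B S₁ h₁ m₁) (H₂ : CoveredBy B S₂ h₂ m₂) (hh : 0 ≤ h₁) :
    CoveredBy B (S₁ + S₂) (h₁ * h₂) (m₁ + m₂) := by
  obtain ⟨Z₁, hZ₁, hS₁⟩ := H₁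
  obtain ⟨Z₂, hZ₂, hS₂⟩ := H₂
  refine ⟨Z₁ + Z₂, ?_, ?_⟩
  · calc (#(Z₁ + Z₂) : ℝ) ≤ #Z₁ * #Z₂ := by exact_mod_cast card_add_le
      _ ≤ h₁ * h₂ := by gcongr
  · refine (add_subset_add hS₁ hS₂).trans (subset_of_eq ?_)
    simp only [add_nsmul, sub_eq_add_neg, neg_add]
    ac_rfl

theorem sub (H₁ : CoveredBy B S₁ h₁ m₁) (H₂ : CoveredBy B S₂ h₂ m₂) (hh : 0 ≤ h₁) :
    CoveredBy B (S₁ - S₂) (h₁ * h₂) (m₁ + m₂) := by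
  obtain ⟨Z₁, hZ₁, hS₁⟩ := H₁
  obtain ⟨Z₂, hZ₂, hS₂⟩ := H₂
  refine ⟨Z₁ - Z₂, ?_, ?_⟩
  · calc (#(Z₁ - Z₂) : ℝ) ≤ #Z₁ * #Z₂ := by exact_mod_cast card_sub_le
      _ ≤ h₁ * h₂ := by gcongr
  · refine (sub_subset_sub hS₁ hS₂).trans (subset_of_eq ?_)
    rw [add_sub_add_comm, sub_eq_add_neg (m₁ • B - m₁ • B), neg_sub, sub_add_sub_comm, add_nsmul]

theorem of_card_sub_le (hB : B.Nonempty) (H : (#(S - B) : ℝ) ≤ h * #B) : CoveredBy B S h 1 := by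
  obtain ⟨Z, -, hZ, hS⟩ := ruzsa_covering_add (A := S) (B := -B) hB.neg (K := h)
    (by rwa [← sub_eq_add_neg, card_neg])
  refine ⟨Z, hZ, hS.trans (subset_of_eq ?_)⟩
  simp only [one_nsmul, sub_eq_add_neg, neg_neg]
  ac_rfl

theorem card_nsmul_sub_nsmul_le (hB : B.Nonempty) (hτ : (#(B - B) : ℝ) ≤ τ * #B) (m n : ℕ) :
    (#(m • B - n • B) : ℝ) ≤ τ ^ (m + n) * #B := by
  have h1 := pluennecke_ruzsa_inequality_nsmul_sub_nsmul_sub hB B m n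
  have h2 : (#(m • B - n • B) : ℝ) ≤ ((#(B - B) : ℝ) / #B) ^ (m + n) * #B := by
    have h2 := (NNRat.cast_le (K := ℝ)).2 h1
    push_cast at h2
    exact h2
  have hpos : (0 : ℝ) < #B := by exact_mod_cast hB.card_pos
  refine h2.trans ?_
  gcongr
  rwa [div_le_iff₀ hpos]

theorem card_le (H : CoveredBy B S h m) (hB : B.Nonempty) (hτ : (#(B - B) : ℝ) ≤ τ * #B)
    (hh : 0 ≤ h) : (#S : ℝ) ≤ h * τ ^ (2 * m) * #B := by
  obtain ⟨Z, hZ, hS⟩ := H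
  calc (#S : ℝ) ≤ #(Z + (m • B - m • B)) := by exact_mod_cast card_le_card hS
    _ ≤ #Z * #(m • B - m • B) := by exact_mod_cast card_add_le
    _ ≤ h * (τ ^ (m + m) * #B) := by
        gcongr
        exact card_nsmul_sub_nsmul_le hB hτ m m
    _ = _ := by rw [← two_mul, mul_assoc]

end Group

variable {F : Type*} [Field F] [DecidableEq F] {B S : Finset F} {h k τ : ℝ} {m : ℕ} {a : F}

theorem smul_self (hB : B.Nonempty) (H : (#(B - a • B) : ℝ) ≤ k * #B) :
    CoveredBy B (a • B) k 1 := by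
  refine of_card_sub_le hB ?_
  rwa [← card_neg, neg_sub]

/-- Dilation brings the multiplicity back to 1, which keeps iterated sums cheap. Ruzsa's triangle
inequality through a • B bounds a • (m • B - m • B) - B: one factor is a dilate of m • B - (m + 1) •
B, controlled by Plünnecke–Ruzsa, the other is the hypothesis on B - a • B. The covering lemma
finishes. -/
theorem smul (hS : CoveredBy B S h m) (hB : B.Nonempty) (ha : a ≠ 0)
    (hτ : (#(B - B) : ℝ) ≤ τ * #B) (H : (#(B - a • B) : ℝ) ≤ k * #B) (hh : 0 ≤ h) (hτ0 : 0 ≤ τ) :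
    CoveredBy B (a • S) (h * (τ ^ (2 * m + 1) * k)) 1 := by
  obtain ⟨Z, hZ, hSZ⟩ := hS
  have hpos : (0 : ℝ) < #B := by exact_mod_cast hB.card_pos
  have h1 : (#(a • (m • B - m • B) - B) : ℝ) ≤ τ ^ (2 * m + 1) * k * #B := by
    have h2 : (#(a • (m • B - m • B) - B) : ℝ) * #(a • B) ≤
        #(a • (m • B - m • B) - a • B) * #(B - a • B) := by
      exact_mod_cast ruzsa_triangle_inequality_sub_sub_sub _ _ _
    rw [← smul_finset_sub_distrib, card_smul_finset₀ ha, card_smul_finset₀ ha] at h2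
    have h3 : m • B - m • B - B = m • B - (m + 1) • B := by
      simp only [add_nsmul, one_nsmul, sub_eq_add_neg, neg_add]
      ac_rfl
    have h4 := card_nsmul_sub_nsmul_le hB hτ m (m + 1)
    rw [h3] at h2
    refine le_of_mul_le_mul_right (h2.trans ?_) hpos
    calc (#(m • B - (m + 1) • B) : ℝ) * #(B - a • B)
        ≤ (τ ^ (m + (m + 1)) * #B) * (k * #B) :=
          mul_le_mul h4 H (by positivity) (by positivity)
      _ = _ := by rw [show m + (m + 1) = 2 * m + 1 by ring]; ring
  obtain ⟨Z', hZ', hS'⟩ := of_card_sub_le hB h1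
  refine ⟨a • Z + Z', ?_, ?_⟩
  · calc (#(a • Z + Z') : ℝ) ≤ #(a • Z) * #Z' := by exact_mod_cast card_add_le
      _ ≤ h * (τ ^ (2 * m + 1) * k) := by
        rw [card_smul_finset₀ ha]
        gcongr
  · calc a • S ⊆ a • (Z + (m • B - m • B)) := smul_finset_subset_smul_finset hSZ
      _ = a • Z + a • (m • B - m • B) := smul_add _ _ _
      _ ⊆ a • Z + (Z' + (1 • B - 1 • B)) := add_subset_add_left hS'
      _ = _ := by rw [add_assoc]

end CoveredBy

open Finset Pointwise in
/-- The set of all `(c - d) x + e (c - d) x + f ((c - d) + (a - b)) x` with the occurrences of `x`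
chosen independently in `B`. -/
def pivotSet {F : Type*} [Field F] [DecidableEq F] (B : Finset F) (a b c d e f : F) : Finset F :=
  (c • B - d • B) + e • (c • B - d • B) + f • ((c • B - d • B) + (a • B - b • B))

-- The three summands have covering numbers k², k³τ⁵ and k⁵τ⁹ and total multiplicity 2 + 1 + 1 = 4;
-- passing from a covering to a cardinality costs a further τ⁸.
open Finset Pointwise in
theorem card_pivotSet_le {F : Type*} [Field F] [DecidableEq F] {B L : Finset F} {k τ : ℝ}
    (hB : B.Nonempty) (hk : 0 ≤ k) (hτ0 : 0 ≤ τ) (hτ : (#(B - B) : ℝ) ≤ τ * #B)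
    (hL0 : ∀ l ∈ L, l ≠ 0) (hL : ∀ l ∈ L, (#(B - l • B) : ℝ) ≤ k * #B) {a b c d e f : F}
    (ha : a ∈ L) (hb : b ∈ L) (hc : c ∈ L) (hd : d ∈ L) (he : e ∈ L) (hf : f ∈ L) :
    (#(pivotSet B a b c d e f) : ℝ) ≤ k ^ 10 * τ ^ 22 * #B := by
  have hself : ∀ l ∈ L, CoveredBy B (l • B) k 1 := fun l hl => .smul_self hB (hL l hl)
  have hU := (hself c hc).sub (hself d hd) hk
  have hV := (hself a ha).sub (hself b hb) hk
  have hW := hU.add hV (by positivity)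
  have h1 := hU.smul hB (hL0 e he) hτ (hL e he) (by positivity) hτ0
  have h2 := hW.smul hB (hL0 f hf) hτ (hL f hf) (by positivity) hτ0
  have h3 := ((hU.add h1 (by positivity)).add h2 (by positivity)).card_le hB hτ (by positivity)
  refine h3.trans (le_of_eq ?_)
  ring

/-! ### Dilates with small sums and the sum-product dichotomy -/

open Finset Pointwise in
/-- Only few dilates of `B` have a small sum with `B`. -/
theorem card_le_of_card_add_smul_le {F : Type*} [Field F] [DecidableEq F] {B S : Finset F} {H : ℝ}
    (hB : B.Nonempty) (hH0 : 0 ≤ H) (hH : 2 * H ≤ #B) (hS : ∀ x ∈ S, (#(B + x • B) : ℝ) ≤ H * #B) :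
    (#S : ℝ) ≤ 2 * H * #B := by
  have hpos : (0 : ℝ) < #B := by exact_mod_cast hB.card_pos
  set Q := (B ×ˢ B) ×ˢ (B ×ˢ B) with hQ
  have hQcard : (#Q : ℝ) = (#B : ℝ) ^ 4 := by
    simp only [hQ, card_product]
    push_cast
    ring
  -- A small B + x • B forces many collisions of (u, v) ↦ u + x v. Those with equal v are diagonal,
  -- at most |B|² in number.
  have hcol : ∀ x ∈ S, (#B : ℝ) ^ 4 ≤ (#B) ^ 2 * (H * #B) +
      H * #B * #{z ∈ {z ∈ Q | z.1.2 ≠ z.2.2} | z.1.1 + x * z.1.2 = z.2.1 + x * z.2.2} := by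
    intro x hx
    have h1 := card_sq_le_card_image_mul_card_collisions (B ×ˢ B) (fun w => w.1 + x * w.2)
    have h2 : (B ×ˢ B).image (fun w => w.1 + x * w.2) ⊆ B + x • B := by
      intro y hy
      obtain ⟨w, hw, rfl⟩ := mem_image.1 hy
      exact add_mem_add (mem_product.1 hw).1 (smul_mem_smul_finset (mem_product.1 hw).2)
    have h3 : #{z ∈ Q | z.1.1 + x * z.1.2 = z.2.1 + x * z.2.2} ≤ #B ^ 2 +
        #{z ∈ {z ∈ Q | z.1.2 ≠ z.2.2} | z.1.1 + x * z.1.2 = z.2.1 + x * z.2.2} := by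
      have h4 : {z ∈ Q | z.1.1 + x * z.1.2 = z.2.1 + x * z.2.2} ⊆
          (B ×ˢ B).image (fun w => (w, w)) ∪
          {z ∈ {z ∈ Q | z.1.2 ≠ z.2.2} | z.1.1 + x * z.1.2 = z.2.1 + x * z.2.2} := by
        rintro ⟨⟨p, q⟩, ⟨r, s⟩⟩ hz
        simp only [hQ, mem_union, mem_image, mem_filter, mem_product, Prod.mk.injEq,
          Prod.exists] at hz ⊢
        by_cases hqs : q = s
        · subst hqs
          left
          exact ⟨p, q, hz.1.1, ⟨rfl, rfl⟩, add_right_cancel hz.2, rfl⟩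
        · right
          exact ⟨⟨hz.1, hqs⟩, hz.2⟩
      refine (card_le_card h4).trans ((card_union_le _ _).trans ?_)
      gcongr
      refine card_image_le.trans (le_of_eq ?_)
      rw [card_product, sq]
    have h5 : (#B : ℝ) ^ 4 ≤ (#(B + x • B) : ℝ) *
        #{z ∈ Q | z.1.1 + x * z.1.2 = z.2.1 + x * z.2.2} := by
      have h6 := h1.trans (Nat.mul_le_mul_right _ (card_le_card h2))
      rw [card_product] at h6
      have h7 : ((#B : ℝ) * #B) ^ 2 ≤ (#(B + x • B) : ℝ) *
        #{z ∈ Q | z.1.1 + x * z.1.2 = z.2.1 + x * z.2.2} := by exact_mod_cast h6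
      refine le_trans (le_of_eq (by ring)) h7
    have h8 : (#{z ∈ Q | z.1.1 + x * z.1.2 = z.2.1 + x * z.2.2} : ℝ) ≤ (#B : ℝ) ^ 2 +
        #{z ∈ {z ∈ Q | z.1.2 ≠ z.2.2} | z.1.1 + x * z.1.2 = z.2.1 + x * z.2.2} := by
      exact_mod_cast h3
    calc (#B : ℝ) ^ 4 ≤ (#(B + x • B) : ℝ) *
          #{z ∈ Q | z.1.1 + x * z.1.2 = z.2.1 + x * z.2.2} := h5
      _ ≤ (H * #B) * ((#B : ℝ) ^ 2 +
          #{z ∈ {z ∈ Q | z.1.2 ≠ z.2.2} | z.1.1 + x * z.1.2 = z.2.1 + x * z.2.2}) :=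
          mul_le_mul (hS x hx) h8 (by positivity) (le_trans (by positivity) (hS x hx))
      _ = _ := by ring
  -- An off-diagonal collision is a linear equation in x with nonzero coefficient, so it serves at
  -- most one x.
  have hdisj : ∑ x ∈ S, #{z ∈ {z ∈ Q | z.1.2 ≠ z.2.2} |
      z.1.1 + x * z.1.2 = z.2.1 + x * z.2.2} ≤ #Q := by
    have h1 := sum_card_bipartiteAbove_eq_sum_card_bipartiteBelow (s := S)
      (t := {z ∈ Q | z.1.2 ≠ z.2.2}) (fun x z => z.1.1 + x * z.1.2 = z.2.1 + x * z.2.2)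
    simp only [bipartiteAbove, bipartiteBelow] at h1
    rw [h1]
    refine (sum_le_card_nsmul _ _ 1 fun z hz => ?_).trans
      (by rw [smul_eq_mul, mul_one]; exact card_filter_le _ _)
    refine card_le_one.2 fun x hx y hy => ?_
    have hx' := (mem_filter.1 hx).2
    have hy' := (mem_filter.1 hy).2
    have h0 := sub_ne_zero.2 (mem_filter.1 hz).2
    refine mul_right_cancel₀ h0 ?_
    linear_combination hx' - hy'
  have hdisj' : ∑ x ∈ S, (#{z ∈ {z ∈ Q | z.1.2 ≠ z.2.2} |
      z.1.1 + x * z.1.2 = z.2.1 + x * z.2.2} : ℝ) ≤ (#B : ℝ) ^ 4 := by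
    rw [← hQcard]
    exact_mod_cast hdisj
  have hHB : 0 ≤ H * #B := by positivity
  have h1 := card_nsmul_le_sum S _ _ hcol
  rw [nsmul_eq_mul, sum_add_distrib, sum_const, nsmul_eq_mul, ← mul_sum] at h1
  have h2 : (#S : ℝ) * #B ^ 4 ≤ #S * (#B ^ 2 * (H * #B)) + H * #B * #B ^ 4 :=
    h1.trans (by gcongr)
  -- Since 2H ≤ |B|, the diagonal takes up at most half of the left side.
  have h3 : (#S : ℝ) * (#B ^ 2 * (2 * H * #B)) ≤ #S * (#B ^ 2 * (#B * #B)) := by gcongr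
  have h4 : (#S : ℝ) * #B ^ 4 ≤ 2 * H * #B * #B ^ 4 := by nlinarith
  exact le_of_mul_le_mul_right h4 (by positivity)

/-- A quadratic polynomial with three distinct roots is zero. -/
theorem eq_zero_of_three_roots {F : Type*} [Field F] {a b c x y z : F} (hxy : x ≠ y) (hxz : x ≠ z)
    (hyz : y ≠ z) (hx : a * x ^ 2 + b * x + c = 0) (hy : a * y ^ 2 + b * y + c = 0)
    (hz : a * z ^ 2 + b * z + c = 0) : a = 0 ∧ b = 0 ∧ c = 0 := by
  have h1 : a * (x + y) + b = 0 := by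
    refine mul_left_cancel₀ (sub_ne_zero.2 hxy) ?_
    linear_combination hx - hy
  have h2 : a * (x + z) + b = 0 := by
    refine mul_left_cancel₀ (sub_ne_zero.2 hxz) ?_
    linear_combination hx - hz
  have ha : a = 0 := by
    refine mul_left_cancel₀ (sub_ne_zero.2 hyz) ?_
    linear_combination h1 - h2
  have hb : b = 0 := by simpa [ha] using h1
  exact ⟨ha, hb, by simpa [ha, hb] using hx⟩

section PrimeField

variable {F : Type*} [Field F]

open Finset

variable (F) in
/-- The prime subfield as a finite set. -/
noncomputable def primeFinset [Finite F] : Finset F := (Set.toFinite ((⊥ : Subfield F) : Set F)).toFinset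

theorem mem_primeFinset [Finite F] {x : F} : x ∈ primeFinset F ↔ x ∈ (⊥ : Subfield F) := by
  simp [primeFinset]

variable (F) in
theorem card_primeFinset [Finite F] (p : ℕ) [Fact p.Prime] [CharP F p] : #(primeFinset F) = p := by
  rw [← Subfield.card_bot F p, primeFinset, ← Set.ncard_eq_toFinset_card]
  exact Nat.card_coe_set_eq _

theorem pow_eq_self_of_mem_bot {p : ℕ} [Fact p.Prime] [CharP F p] {x : F} (hx : x ∈ (⊥ : Subfield F)) : x ^ p = x :=
  (Subfield.mem_bot_iff_pow_eq_self F p).1 hx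

theorem mem_bot_iff_natCast (p : ℕ) [Fact p.Prime] [CharP F p] {x : F} : x ∈ (⊥ : Subfield F) ↔ ∃ n : ℕ, (n : F) = x := by
  simp [← ZMod.fieldRange_castHom_eq_bot p, ZMod.natCast_zmod_surjective.exists]

theorem add_mem_of_forall_add_one_mem (p : ℕ) [Fact p.Prime] [CharP F p] {R : Finset F} (h : ∀ x ∈ R, x + 1 ∈ R) {x i : F}
    (hx : x ∈ R) (hi : i ∈ (⊥ : Subfield F)) : x + i ∈ R := by
  obtain ⟨n, rfl⟩ := (mem_bot_iff_natCast p).1 hi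
  induction n with
  | zero => simpa using hx
  | succ n ih =>
    have := h _ (ih (natCast_mem _ n))
    rwa [add_assoc, ← Nat.cast_succ] at this

theorem card_le_of_forall_add_one_mem [Finite F] (p : ℕ) [Fact p.Prime] [CharP F p] {R : Finset F} (h : ∀ x ∈ R, x + 1 ∈ R) (h0 : R.Nonempty) :
    p ≤ #R := by
  obtain ⟨x, hx⟩ := h0
  rw [← card_primeFinset F p]
  refine card_le_card_of_injOn (fun i => x + i) (fun i hi => ?_) fun i _ j _ hij =>
    add_left_cancel hij
  exact add_mem_of_forall_add_one_mem p h hx (mem_primeFinset.1 hi)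

/-- A finite set closed under `x ↦ x + 1` and inversion is contained in the prime subfield, or it
contains a positive proportion of `p ^ 2` elements. -/
theorem sq_le_of_forall_add_one_mem_of_inv_mem [Finite F] {p : ℕ} [Fact p.Prime] [CharP F p]
    {R : Finset F} (h : ∀ x ∈ R, x + 1 ∈ R)
    (hinv : ∀ x ∈ R, x⁻¹ ∈ R) {r : F} (hr : r ∈ R) (hr' : r ∉ (⊥ : Subfield F)) :
    p ^ 2 ≤ 2 * #R := by
  classical
  have hne : ∀ i ∈ (⊥ : Subfield F), r + i ≠ 0 := by
    intro i hi h0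
    rw [eq_neg_of_add_eq_zero_left h0] at hr'
    exact hr' (neg_mem hi)
  have hrp : r ^ p ≠ r := fun h => hr' ((Subfield.mem_bot_iff_pow_eq_self F p).2 h)
  rw [← card_primeFinset F p, sq, ← card_product]
  refine card_le_mul_card_image_of_maps_to (f := fun z : F × F => (r + z.1)⁻¹ + z.2) ?_ _ ?_
  · rintro ⟨i, j⟩ hz
    obtain ⟨hi, hj⟩ := mem_product.1 hz
    exact add_mem_of_forall_add_one_mem p h
      (hinv _ (add_mem_of_forall_add_one_mem p h hr (mem_primeFinset.1 hi)))
      (mem_primeFinset.1 hj)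
  · intro b _
    by_contra! hcon
    obtain ⟨⟨i₁, j₁⟩, h1, ⟨i₂, j₂⟩, h2, ⟨i₃, j₃⟩, h3, h12, h13, h23⟩ := two_lt_card.1 hcon
    -- Eliminating j between the equation (r + i)⁻¹ + j = b and its Frobenius image leaves a
    -- quadratic in i, nonzero because r^p ≠ r. Hence the fibres have at most two elements.
    have key : ∀ i j : F, (i, j) ∈ ({a ∈ primeFinset F ×ˢ primeFinset F |
        (r + a.1)⁻¹ + a.2 = b} : Finset (F × F)) →
        j = b - (r + i)⁻¹ ∧
        (b - b ^ p) * i ^ 2 + (b - b ^ p) * (r + r ^ p) * i +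
          ((b - b ^ p) * (r * r ^ p) - (r ^ p - r)) = 0 := by
      intro i j hij
      simp only [mem_filter, mem_product, mem_primeFinset] at hij
      obtain ⟨⟨hi, hj⟩, hb⟩ := hij
      refine ⟨by rw [← hb]; ring, ?_⟩
      have e1 := hne i hi
      have e2 : b ^ p = (r ^ p + i)⁻¹ + j := by
        rw [← hb, add_pow_char, inv_pow, add_pow_char, pow_eq_self_of_mem_bot hi,
          pow_eq_self_of_mem_bot hj]
      have e3 : r ^ p + i ≠ 0 := by
        have := pow_ne_zero p e1
        rwa [add_pow_char, pow_eq_self_of_mem_bot hi] at this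
      rw [e2, ← hb]
      field_simp
      ring
    obtain ⟨a1, b1⟩ := key _ _ h1
    obtain ⟨a2, b2⟩ := key _ _ h2
    obtain ⟨a3, b3⟩ := key _ _ h3
    have d12 : i₁ ≠ i₂ := by rintro rfl; exact h12 (by rw [a1, a2])
    have d13 : i₁ ≠ i₃ := by rintro rfl; exact h13 (by rw [a1, a3])
    have d23 : i₂ ≠ i₃ := by rintro rfl; exact h23 (by rw [a2, a3])
    obtain ⟨z1, -, z3⟩ := eq_zero_of_three_roots d12 d13 d23 b1 b2 b3
    rw [z1, zero_mul, zero_sub, neg_eq_zero] at z3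
    exact hrp (sub_eq_zero.1 z3)

open Pointwise in
/-- **Sum-product dichotomy.** If all pivot sets of `L` over `B` are small compared with `B`, then
`L` is small, or `B` is large compared with the field, or all ratios of differences of elements of
`L` lie in the prime subfield. -/
theorem pivot_trichotomy [Finite F] [DecidableEq F] {p : ℕ} [Fact p.Prime] [CharP F p]
    {L B : Finset F} {H : ℝ} (hB : B.Nonempty)
    (hL : 2 ≤ #L) (hL0 : ∀ l ∈ L, l ≠ 0) (hH0 : 0 ≤ H) (hH : 2 * H ≤ #B)
    (hT : ∀ a ∈ L, ∀ b ∈ L, ∀ c ∈ L, ∀ d ∈ L, ∀ e ∈ L, ∀ f ∈ L,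
      (#(pivotSet B a b c d e f) : ℝ) ≤ H * #B) :
    (#L : ℝ) ^ 2 ≤ 2 * H * #B ∨ (p : ℝ) ^ 2 ≤ 4 * H * #B ∨
      ((p : ℝ) ≤ 2 * H * #B ∧
        ∀ a ∈ L, ∀ b ∈ L, ∀ c ∈ L, ∀ d ∈ L, c ≠ d → (a - b) / (c - d) ∈ (⊥ : Subfield F)) := by
  set R : Finset F := (((L ×ˢ L) ×ˢ (L ×ˢ L)).filter fun z => z.2.1 ≠ z.2.2).image
    fun z => (z.1.1 - z.1.2) / (z.2.1 - z.2.2) with hR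
  have memR : ∀ x, x ∈ R ↔ ∃ a ∈ L, ∃ b ∈ L, ∃ c ∈ L, ∃ d ∈ L, c ≠ d ∧
      (a - b) / (c - d) = x := by
    intro x
    simp only [hR, mem_image, mem_filter, mem_product, Prod.exists]
    constructor
    · rintro ⟨a, b, c, d, ⟨⟨⟨ha, hb⟩, hc, hd⟩, hcd⟩, rfl⟩
      exact ⟨a, ha, b, hb, c, hc, d, hd, hcd, rfl⟩
    · rintro ⟨a, ha, b, hb, c, hc, d, hd, hcd, rfl⟩
      exact ⟨a, b, c, d, ⟨⟨⟨ha, hb⟩, hc, hd⟩, hcd⟩, rfl⟩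
  have hLne : L.Nonempty := card_pos.1 (by omega)
  by_cases hclosed : ∀ x ∈ R, x + 1 ∈ R
  · right
    have hRcard : (#R : ℝ) ≤ 2 * H * #B := by
      refine card_le_of_card_add_smul_le hB hH0 hH fun x hx => ?_
      obtain ⟨a, ha, b, hb, c, hc, d, hd, hcd, rfl⟩ := (memR x).1 hx
      refine le_trans ?_ (hT a ha b hb c hc d hd c hc c hc)
      have hcd' : c - d ≠ 0 := sub_ne_zero.2 hcd
      -- Multiplying by c - d clears the denominator; the resulting set is, up to dilation, the last
      -- summand of a pivot set.
      have h1 : #(B + ((a - b) / (c - d)) • B) ≤ #((c • B - d • B) + (a • B - b • B)) := by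
        rw [← card_smul_finset₀ hcd' (B + ((a - b) / (c - d)) • B)]
        refine card_le_card fun y hy => ?_
        obtain ⟨_, hz, rfl⟩ := mem_smul_finset.1 hy
        obtain ⟨u, hu, _, hv', rfl⟩ := mem_add.1 hz
        obtain ⟨v, hv, rfl⟩ := mem_smul_finset.1 hv'
        refine mem_add.2 ⟨c * u - d * u, sub_mem_sub (smul_mem_smul_finset hu)
          (smul_mem_smul_finset hu), a * v - b * v, sub_mem_sub (smul_mem_smul_finset hv)
          (smul_mem_smul_finset hv), ?_⟩
        simp only [smul_eq_mul]
        field_simp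
      have h2 : #((c • B - d • B) + (a • B - b • B)) ≤ #(pivotSet B a b c d c c) := by
        rw [← card_smul_finset₀ (hL0 c hc) ((c • B - d • B) + (a • B - b • B)), pivotSet]
        refine card_le_card_add_left ?_
        have : (c • B - d • B).Nonempty := hB.smul_finset.sub hB.smul_finset
        exact this.add this.smul_finset
      exact_mod_cast h1.trans h2
    have hRinv : ∀ x ∈ R, x⁻¹ ∈ R := by
      intro x hx
      obtain ⟨a, ha, b, hb, c, hc, d, hd, hcd, rfl⟩ := (memR x).1 hx
      by_cases hab : a = b
      · simpa [hab] using hx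
      · exact (memR _).2 ⟨c, hc, d, hd, a, ha, b, hb, hab, by rw [inv_div]⟩
    by_cases hsub : ∀ x ∈ R, x ∈ (⊥ : Subfield F)
    · right
      refine ⟨?_, fun a ha b hb c hc d hd hcd =>
        hsub _ ((memR _).2 ⟨a, ha, b, hb, c, hc, d, hd, hcd, rfl⟩)⟩
      refine le_trans ?_ hRcard
      obtain ⟨c, hc, d, hd, hcd⟩ := one_lt_card.1 (by omega : 1 < #L)
      exact_mod_cast card_le_of_forall_add_one_mem p hclosed
        ⟨_, (memR _).2 ⟨c, hc, d, hd, c, hc, d, hd, hcd, rfl⟩⟩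
    · left
      push Not at hsub
      obtain ⟨r, hr, hr'⟩ := hsub
      have h1 : ((p ^ 2 : ℕ) : ℝ) ≤ (2 * #R : ℕ) :=
        Nat.cast_le.2 (sq_le_of_forall_add_one_mem_of_inv_mem hclosed hRinv hr hr')
      push_cast at h1
      linarith
  · left
    push Not at hclosed
    obtain ⟨x, hx, hx'⟩ := hclosed
    -- A collision of (e, f) and (e', f') with f ≠ f' would give x + 1 = (e - e')/(f' - f), an
    -- element of R.
    have hcard : #L ^ 2 = #((L ×ˢ L).image fun z => z.1 + z.2 * (x + 1)) := by
      rw [card_image_of_injOn, card_product, sq]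
      rintro ⟨e, f⟩ h1 ⟨e', f'⟩ h2 heq
      simp only [coe_product, Set.mem_prod, mem_coe] at h1 h2
      simp only at heq
      by_cases hff : f = f'
      · subst hff
        rw [add_right_cancel heq]
      · refine absurd ((memR _).2 ⟨e, h1.1, e', h2.1, f', h2.2, f, h1.2, fun h => hff h.symm, ?_⟩) hx'
        have : f' - f ≠ 0 := sub_ne_zero.2 fun h => hff h.symm
        rw [div_eq_iff this]
        linear_combination heq
    have h1 : ((#L ^ 2 : ℕ) : ℝ) ≤ 2 * H * #B := by
      rw [hcard]
      refine card_le_of_card_add_smul_le hB hH0 hH fun y hy => ?_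
      obtain ⟨⟨e, f⟩, hef, rfl⟩ := mem_image.1 hy
      obtain ⟨he, hf⟩ := mem_product.1 hef
      obtain ⟨a, ha, b, hb, c, hc, d, hd, hcd, rfl⟩ := (memR x).1 hx
      refine le_trans ?_ (hT a ha b hb c hc d hd e he f hf)
      have hcd' : c - d ≠ 0 := sub_ne_zero.2 hcd
      refine Nat.cast_le.2 ?_
      rw [← card_smul_finset₀ hcd' (B + _)]
      refine card_le_card fun y hy => ?_
      obtain ⟨_, hz, rfl⟩ := mem_smul_finset.1 hy
      obtain ⟨u, hu, _, hv', rfl⟩ := mem_add.1 hz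
      obtain ⟨v, hv, rfl⟩ := mem_smul_finset.1 hv'
      have hm : ∀ l w : F, w ∈ B → l * w ∈ l • B := fun l w hw => smul_mem_smul_finset hw
      -- This identity dictates the shape of `pivotSet`.
      have e0 : (c - d) • (u + (e + f * ((a - b) / (c - d) + 1)) • v) =
          (c * u - d * u) + e * (c * v - d * v) + f * ((c * v - d * v) + (a * v - b * v)) := by
        simp only [smul_eq_mul]
        field_simp
        ring
      rw [e0]
      exact add_mem_add (add_mem_add (sub_mem_sub (hm _ _ hu) (hm _ _ hu))
        (smul_mem_smul_finset (sub_mem_sub (hm _ _ hv) (hm _ _ hv))))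
        (smul_mem_smul_finset (add_mem_add (sub_mem_sub (hm _ _ hv) (hm _ _ hv))
          (sub_mem_sub (hm _ _ hv) (hm _ _ hv))))
    exact_mod_cast h1

end PrimeField

/-! ### Möbius maps and translates of the prime subfield -/

open Finset in
/-- If the prime subfield meets the image of `D` under a Möbius transformation with pole `b` in all
of that image, and `D` is covered by subsets `A j` of parallel translates of the prime subfield,
then `D` has at most `2 * #J` elements outside a single one of these subsets. -/
theorem card_le_of_mobius_mem_bot {F : Type*} [Field F] [Finite F] [DecidableEq F] {p : ℕ}
    [Fact p.Prime] [CharP F p] {t : F} (ht : t ∉ (⊥ : Subfield F)) {J : Finset F}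
    (hJ : ∀ j ∈ J, j ∈ (⊥ : Subfield F)) {A : F → Finset F}
    (hA : ∀ j ∈ J, (A j : Set F) ⊆ primeTranslate (j * t)) {N : ℝ} (hN : 0 ≤ N)
    (hAN : ∀ j ∈ J, (#(A j) : ℝ) ≤ N) {D : Finset F} (hD : ∀ a ∈ D, ∃ j ∈ J, a ∈ A j)
    {r s b : F} (hrs : r * b + s ≠ 0) (hb : b ∉ D)
    (hz : ∀ a ∈ D, (r * a + s) / (a - b) ∈ (⊥ : Subfield F)) :
    (#D : ℝ) ≤ 2 * #J + N := by
  have hDsum : (#D : ℝ) ≤ ∑ j ∈ J, (#(D ∩ A j) : ℝ) := by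
    have h1 : D ⊆ J.biUnion fun j => D ∩ A j := by
      intro a ha
      obtain ⟨j, hj, haj⟩ := hD a ha
      exact mem_biUnion.2 ⟨j, hj, mem_inter.2 ⟨ha, haj⟩⟩
    exact_mod_cast (card_le_card h1).trans card_biUnion_le
  -- three points of `D` on one translate force the whole translate into the prime subfield
  have hfull : ∀ j ∈ J, 2 < #(D ∩ A j) → ∀ i ∈ (⊥ : Subfield F), i + j * t ≠ b →
      (r * (i + j * t) + s) / (i + j * t - b) ∈ (⊥ : Subfield F) := by
    intro j hj hcard i hi hib
    have hjp := pow_eq_self_of_mem_bot (p := p) (hJ j hj)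
    -- For a = i + j t, invariance of (r a + s)/(a - b) under Frobenius is a quadratic equation in
    -- i. Three solutions make it vanish identically.
    have key : ∀ a ∈ D ∩ A j, ∃ i, a = i + j * t ∧ (r - r ^ p) * i ^ 2 +
        (r * (j * t ^ p - b ^ p) + (r * (j * t) + s) -
          (r ^ p * (j * t ^ p) + s ^ p + (j * t - b) * r ^ p)) * i +
        ((r * (j * t) + s) * (j * t ^ p - b ^ p) - (j * t - b) * (r ^ p * (j * t ^ p) + s ^ p))
          = 0 := by
      intro a ha
      obtain ⟨haD, haA⟩ := mem_inter.1 ha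
      obtain ⟨i, hi, rfl⟩ := hA j hj haA
      refine ⟨i, rfl, ?_⟩
      have hab : i + j * t - b ≠ 0 := sub_ne_zero.2 fun h => hb (h ▸ haD)
      have h1 := hz _ haD
      have h2 := pow_eq_self_of_mem_bot (p := p) h1
      have h3 : (i + j * t) ^ p = i + j * t ^ p := by
        rw [add_pow_char, mul_pow, hjp, pow_eq_self_of_mem_bot hi]
      have h4 : i + j * t ^ p - b ^ p ≠ 0 := by
        rw [← h3, ← sub_pow_char]
        exact pow_ne_zero _ hab
      rw [div_pow, add_pow_char, mul_pow, sub_pow_char, h3, div_eq_div_iff h4 hab] at h2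
      linear_combination -h2
    obtain ⟨x, hx, y, hy, z, hz', hxy, hxz, hyz⟩ := two_lt_card.1 hcard
    obtain ⟨x', rfl, hx'⟩ := key x hx
    obtain ⟨y', rfl, hy'⟩ := key y hy
    obtain ⟨z', rfl, hz''⟩ := key z hz'
    obtain ⟨e1, e2, e3⟩ := eq_zero_of_three_roots (fun h => hxy (by rw [h]))
      (fun h => hxz (by rw [h])) (fun h => hyz (by rw [h])) hx' hy' hz''
    rw [Subfield.mem_bot_iff_pow_eq_self F p]
    have hab : i + j * t - b ≠ 0 := sub_ne_zero.2 hib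
    have h3 : (i + j * t) ^ p = i + j * t ^ p := by
      rw [add_pow_char, mul_pow, hjp, pow_eq_self_of_mem_bot hi]
    have h4 : i + j * t ^ p - b ^ p ≠ 0 := by
      rw [← h3, ← sub_pow_char]
      exact pow_ne_zero _ hab
    rw [div_pow, add_pow_char, mul_pow, sub_pow_char, h3, div_eq_div_iff h4 hab]
    linear_combination (-i ^ 2) * e1 - i * e2 - e3
  have huniq : ∀ j ∈ J, ∀ j' ∈ J, 2 < #(D ∩ A j) → 2 < #(D ∩ A j') → j = j' := by
    intro j hj j' hj' hc hc'
    by_contra hne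
    have htj : ∀ i ∈ (⊥ : Subfield F), ∀ i' ∈ (⊥ : Subfield F), i + j * t ≠ i' + j' * t := by
      intro i hi i' hi' heq
      refine ht ?_
      have h0 : j - j' ≠ 0 := sub_ne_zero.2 hne
      have : t = (i' - i) / (j - j') := by
        rw [eq_div_iff h0]
        linear_combination heq
      rw [this]
      exact div_mem (sub_mem hi' hi) (sub_mem (hJ j hj) (hJ j' hj'))
    set U := (primeFinset F).image (fun i => i + j * t) with hU
    set U' := (primeFinset F).image (fun i => i + j' * t) with hU'
    have hUc : #U = p := by
      rw [hU, card_image_of_injective _ (add_left_injective _), card_primeFinset F p]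
    have hUc' : #U' = p := by
      rw [hU', card_image_of_injective _ (add_left_injective _), card_primeFinset F p]
    have hdisj : Disjoint U U' := by
      rw [disjoint_left]
      intro a ha ha'
      obtain ⟨i, hi, rfl⟩ := mem_image.1 ha
      obtain ⟨i', hi', h⟩ := mem_image.1 ha'
      exact htj i (mem_primeFinset.1 hi) i' (mem_primeFinset.1 hi') h.symm
    -- The Möbius map is injective because r b + s ≠ 0, so two full translates minus the pole would
    -- put at least 2p - 1 > p elements in the prime subfield.
    have h1 : #((U ∪ U').erase b) ≤ #(primeFinset F) := by
      refine card_le_card_of_injOn (fun a => (r * a + s) / (a - b)) ?_ ?_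
      · intro a ha
        obtain ⟨hab, ha⟩ := mem_erase.1 ha
        refine mem_primeFinset.2 ?_
        rcases mem_union.1 ha with ha | ha
        · obtain ⟨i, hi, rfl⟩ := mem_image.1 ha
          exact hfull j hj hc i (mem_primeFinset.1 hi) hab
        · obtain ⟨i, hi, rfl⟩ := mem_image.1 ha
          exact hfull j' hj' hc' i (mem_primeFinset.1 hi) hab
      · intro a ha a' ha' heq
        have h2 := sub_ne_zero.2 (mem_erase.1 ha).1
        have h3 := sub_ne_zero.2 (mem_erase.1 ha').1
        simp only at heq
        rw [div_eq_div_iff h2 h3] at heq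
        have h4 : (r * b + s) * (a' - a) = 0 := by linear_combination heq
        rcases mul_eq_zero.1 h4 with h4 | h4
        · exact absurd h4 hrs
        · exact (sub_eq_zero.1 h4).symm
    have h2 := pred_card_le_card_erase (s := U ∪ U') (a := b)
    rw [card_union_of_disjoint hdisj, hUc, hUc'] at h2
    rw [card_primeFinset F p] at h1
    have := (Fact.out : p.Prime).two_le
    omega
  by_cases hbad : ∃ j ∈ J, 2 < #(D ∩ A j)
  · obtain ⟨j, hj, hc⟩ := hbad
    rw [← add_sum_erase J _ hj] at hDsum
    have h1 : (#(D ∩ A j) : ℝ) ≤ N :=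
      le_trans (by exact_mod_cast card_le_card inter_subset_right) (hAN j hj)
    have h2 : ∑ i ∈ J.erase j, (#(D ∩ A i) : ℝ) ≤ #(J.erase j) • (2 : ℝ) := by
      refine sum_le_card_nsmul _ _ _ fun i hi => ?_
      have := mem_erase.1 hi
      by_contra! hcon
      exact this.1 (huniq i this.2 j hj (by exact_mod_cast hcon) hc)
    have h3 : (#(J.erase j) : ℝ) ≤ #J := by exact_mod_cast card_erase_le
    rw [nsmul_eq_mul] at h2
    linarith
  · push Not at hbad
    have h2 : ∑ i ∈ J, (#(D ∩ A i) : ℝ) ≤ #J • (2 : ℝ) :=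
      sum_le_card_nsmul _ _ _ fun i hi => by exact_mod_cast hbad i hi
    rw [nsmul_eq_mul] at h2
    linarith

/-! ### Pencils of few-valued linear forms -/

open Finset in
/-- Two members of a dense family of pencils `S a` share many points with many other members. -/
theorem exists_pair_many_large_inter {F α : Type*} [DecidableEq F] [DecidableEq α] {q M : ℝ}
    (hq : 2 ^ 11 ≤ q) (hM : 0 < M) {D : Finset F} (hD : q ^ 6418 ≤ #D) {T : Finset α}
    (hT : (#T : ℝ) ≤ M ^ 2) {S : F → Finset α} (hST : ∀ a ∈ D, S a ⊆ T)
    (hS : ∀ a ∈ D, M ^ 2 / (4 * q ^ 2) ≤ #(S a)) :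
    ∃ a₁ ∈ D, ∃ a₂ ∈ D, a₁ ≠ a₂ ∧ ∃ D₁ ⊆ D, a₁ ∉ D₁ ∧ a₂ ∉ D₁ ∧ q ^ 6402 ≤ #D₁ ∧
      ∀ a ∈ D₁, M ^ 2 / (2 ^ 11 * q ^ 8) ≤ #((S a ∩ S a₁) ∩ (S a₂ ∩ S a₁)) := by
  have hq0 : 0 < q := by linarith
  have hq1 : 1 ≤ q := by linarith
  -- One spare factor q pays for removing a single element, here a₁ and later a₂. Likewise q ≥ 2^11
  -- absorbs each numerical constant.
  have hstep : ∀ m : ℕ, ∀ x : ℝ, q ^ (m + 1) ≤ x → q ^ m ≤ x - 1 := by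
    intro m x hx
    have h1 : 1 ≤ q ^ m := one_le_pow₀ hq1
    rw [pow_succ] at hx
    nlinarith
  have hDne : D.Nonempty := by
    rw [← card_pos]
    have : 0 < q ^ 6418 := by positivity
    exact_mod_cast this.trans_le hD
  obtain ⟨a₁, ha₁, hc₁⟩ := exists_many_large_inter hDne S T (N := M ^ 2) (ρ := 1 / (4 * q ^ 2))
    (by positivity) (by positivity) hT hST
    (fun a ha => le_trans (le_of_eq (by ring)) (hS a ha))
  set I₁ := {a ∈ D | (1 / (4 * q ^ 2)) ^ 2 * M ^ 2 / 2 ≤ (#(S a ∩ S a₁) : ℝ)} with hI₁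
  have hI₁c : q ^ 6413 ≤ #I₁ := by
    have h1 : (1 / (4 * q ^ 2)) ^ 2 * (#D : ℝ) = #D / (16 * q ^ 4) := by ring
    rw [h1, div_le_iff₀ (by positivity)] at hc₁
    have h2 : q ^ 6413 * (32 * q ^ 4) ≤ #I₁ * (32 * q ^ 4) :=
      calc q ^ 6413 * (32 * q ^ 4) = q ^ 6417 * 32 := by ring
        _ ≤ q ^ 6417 * q := by gcongr; linarith
        _ = q ^ 6418 := by ring
        _ ≤ #D := hD
        _ ≤ 2 * #I₁ * (16 * q ^ 4) := hc₁
        _ = _ := by ring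
    exact le_of_mul_le_mul_right h2 (by positivity)
  set I₂ := I₁.erase a₁ with hI₂
  have hI₂c : q ^ 6412 ≤ #I₂ := by
    have h1 : (#I₁ : ℝ) - 1 ≤ #I₂ := by
      have := pred_card_le_card_erase (s := I₁) (a := a₁)
      rw [sub_le_iff_le_add]
      exact_mod_cast Nat.sub_le_iff_le_add.1 this
    exact (hstep _ _ hI₁c).trans h1
  have hI₂ne : I₂.Nonempty := by
    rw [← card_pos]
    have : 0 < q ^ 6412 := by positivity
    exact_mod_cast this.trans_le hI₂c
  have hI₂D : I₂ ⊆ D := (erase_subset _ _).trans (filter_subset _ _)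
  obtain ⟨a₂, ha₂, hc₂⟩ := exists_many_large_inter hI₂ne (fun a => S a ∩ S a₁) T (N := M ^ 2)
    (ρ := 1 / (32 * q ^ 4)) (by positivity) (by positivity) hT
    (fun a ha => inter_subset_left.trans (hST a (hI₂D ha)))
    (fun a ha => le_trans (le_of_eq (by ring)) (mem_filter.1 (mem_erase.1 ha).2).2)
  set I₃ := {a ∈ I₂ | (1 / (32 * q ^ 4)) ^ 2 * M ^ 2 / 2 ≤
    (#((S a ∩ S a₁) ∩ (S a₂ ∩ S a₁)) : ℝ)} with hI₃
  have hI₃c : q ^ 6403 ≤ #I₃ := by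
    have h1 : (1 / (32 * q ^ 4)) ^ 2 * (#I₂ : ℝ) = #I₂ / (2 ^ 10 * q ^ 8) := by ring
    rw [h1, div_le_iff₀ (by positivity)] at hc₂
    have h2 : q ^ 6403 * (2 ^ 11 * q ^ 8) ≤ #I₃ * (2 ^ 11 * q ^ 8) :=
      calc q ^ 6403 * (2 ^ 11 * q ^ 8) = q ^ 6411 * 2 ^ 11 := by ring
        _ ≤ q ^ 6411 * q := by gcongr
        _ = q ^ 6412 := by ring
        _ ≤ #I₂ := hI₂c
        _ ≤ 2 * #I₃ * (2 ^ 10 * q ^ 8) := hc₂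
        _ = _ := by ring
    exact le_of_mul_le_mul_right h2 (by positivity)
  refine ⟨a₁, ha₁, a₂, hI₂D ha₂, (mem_erase.1 ha₂).1.symm, I₃.erase a₂,
    (erase_subset _ _).trans ((filter_subset _ _).trans hI₂D), ?_, notMem_erase _ _, ?_, ?_⟩
  · intro h
    exact (mem_erase.1 (mem_filter.1 (mem_erase.1 h).2).1).1 rfl
  · have h1 : (#I₃ : ℝ) - 1 ≤ #(I₃.erase a₂) := by
      have := pred_card_le_card_erase (s := I₃) (a := a₂)
      rw [sub_le_iff_le_add]
      exact_mod_cast Nat.sub_le_iff_le_add.1 this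
    exact (hstep _ _ hI₃c).trans h1
  · intro a ha
    refine le_trans (le_of_eq ?_) (mem_filter.1 (mem_erase.1 ha).2).2
    ring

open Finset Pointwise in
/-- Sets whose sums along the dilates `l • Y`, `l ∈ D`, are few along dense graphs: either the field
is small, or many elements of `D` have all their ratios of differences in the prime subfield. -/
theorem exists_ratios_mem_bot {F : Type*} [Field F] [Finite F] [DecidableEq F] {p : ℕ}
    [Fact p.Prime] [CharP F p] {q : ℝ} (hq : 2 ^ 11 ≤ q)
    (X Y D : Finset F) (hD : q ^ 6402 ≤ #D) (hD0 : ∀ l ∈ D, l ≠ 0) (G : F → Finset (F × F))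
    (hG : ∀ l ∈ D, G l ⊆ X ×ˢ Y) (hX : (#X : ℝ) ≤ 2 * q ^ 6419) (hY : (#Y : ℝ) ≤ 2 * q ^ 6419)
    (h : ∀ l ∈ D, (2 * q ^ 6419) ^ 2 / (2 ^ 11 * q ^ 8) ≤ #(G l))
    (hsum : ∀ l ∈ D, (#((G l).image fun z => z.1 + l * z.2) : ℝ) ≤ 2 * q ^ 6419) :
    (p : ℝ) ^ 2 ≤ q ^ 11272 ∨ ((p : ℝ) ≤ q ^ 11272 ∧ ∃ D' ⊆ D, q ^ 6361 ≤ #D' ∧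
      ∀ a ∈ D', ∀ b ∈ D', ∀ c ∈ D', ∀ d ∈ D', c ≠ d →
        (a - b) / (c - d) ∈ (⊥ : Subfield F)) := by
  have hq0 : 0 < q := by linarith
  have hq1 : 1 ≤ q := by linarith
  have hDne : D.Nonempty := by
    rw [← card_pos]
    have : 0 < q ^ 6402 := by positivity
    exact_mod_cast this.trans_le hD
  set κ : ℝ := 2 ^ 11 * q ^ 8 with hκ
  have hκ0 : 0 < κ := by positivity
  have hκq : κ ≤ q ^ 9 :=
    calc κ ≤ q * q ^ 8 := by rw [hκ]; gcongr
      _ = q ^ 9 := by ring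
  obtain ⟨B, hBX, l₀, hl₀, D', hD', hBc, hDc, hBB, hBl⟩ := exists_small_sub_smul X Y D hDne hD0 G
    hG (M := 2 * q ^ 6419) (κ := κ) (by positivity) hκ0 hX hY h hsum
  clear_value κ
  have hl₀0 := hD0 l₀ hl₀
  have h8κ : 8 * κ ≤ q ^ 10 :=
    calc 8 * κ ≤ q * q ^ 9 := by gcongr; linarith
      _ = q ^ 10 := by ring
  have hBlow : 2 * q ^ 6409 ≤ #B := by
    have h1 : 2 * q ^ 6409 * q ^ 10 ≤ #B * q ^ 10 :=
      calc 2 * q ^ 6409 * q ^ 10 = 2 * q ^ 6419 := by ring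
        _ ≤ 8 * κ * #B := hBc
        _ ≤ q ^ 10 * #B := by gcongr
        _ = _ := by ring
    exact le_of_mul_le_mul_right h1 (by positivity)
  have hBhigh : (#B : ℝ) ≤ 2 * q ^ 6419 := le_trans (by exact_mod_cast card_le_card hBX) hX
  have hBne : B.Nonempty := by
    rw [← card_pos]
    have : 0 < 2 * q ^ 6409 := by positivity
    exact_mod_cast this.trans_le hBlow
  have hD'c : q ^ 6361 ≤ #D' := by
    have h1 : q ^ 6361 * q ^ 41 ≤ #D' * q ^ 41 :=
      calc q ^ 6361 * q ^ 41 = q ^ 6402 := by ring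
        _ ≤ (#D : ℝ) := hD
        _ ≤ 2 * (8 * κ) ^ 4 * #D' := hDc
        _ ≤ q * (q ^ 10) ^ 4 * #D' := by gcongr; linarith
        _ = _ := by ring
    exact le_of_mul_le_mul_right h1 (by positivity)
  have hdivinj : Function.Injective fun l : F => l / l₀ := fun a b hab => by
    simpa [hl₀0] using hab
  set L := D'.image (fun l => l / l₀) with hL
  have hLc : #L = #D' := card_image_of_injective _ hdivinj
  have hL0 : ∀ l ∈ L, l ≠ 0 := by
    intro l hl
    obtain ⟨l', hl', rfl⟩ := mem_image.1 hl
    exact div_ne_zero (hD0 _ (hD' hl')) hl₀0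
  set k : ℝ := 2 ^ 67 * κ ^ 26 with hk
  set τ : ℝ := 2 ^ 30 * κ ^ 12 with hτ
  have hkq : k ≤ q ^ 241 :=
    calc k ≤ q ^ 7 * (q ^ 9) ^ 26 := by
          rw [hk]
          gcongr
          calc (2 : ℝ) ^ 67 ≤ (2 ^ 11) ^ 7 := by norm_num
            _ ≤ q ^ 7 := by gcongr
      _ = q ^ 241 := by ring
  have hτq : τ ≤ q ^ 111 :=
    calc τ ≤ q ^ 3 * (q ^ 9) ^ 12 := by
          rw [hτ]
          gcongr
          calc (2 : ℝ) ^ 30 ≤ (2 ^ 11) ^ 3 := by norm_num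
            _ ≤ q ^ 3 := by gcongr
      _ = q ^ 111 := by ring
  have hk0 : 0 ≤ k := by positivity
  have hτ0 : 0 ≤ τ := by positivity
  clear_value k τ
  -- 4852 = 10 · 241 + 22 · 111. With |B| ≤ 2 q^6419 and one factor q for the constants, this gives
  -- 11272 = 4852 + 6419 + 1.
  have hH : k ^ 10 * τ ^ 22 ≤ q ^ 4852 :=
    calc k ^ 10 * τ ^ 22 ≤ (q ^ 241) ^ 10 * (q ^ 111) ^ 22 := by gcongr
      _ = q ^ 4852 := by ring
  have hup : 4 * q ^ 4852 * #B ≤ q ^ 11272 :=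
    calc 4 * q ^ 4852 * #B ≤ 4 * q ^ 4852 * (2 * q ^ 6419) := by gcongr
      _ = 8 * q ^ 11271 := by ring
      _ ≤ q * q ^ 11271 := by gcongr; linarith
      _ = _ := by ring
  have hup' : 2 * q ^ 4852 * #B ≤ q ^ 11272 := by
    have : 0 ≤ q ^ 4852 * #B := by positivity
    linarith
  have hL2 : 2 ≤ #L := by
    rw [hLc]
    have h1 : q ^ 1 ≤ q ^ 6361 := pow_le_pow_right₀ hq1 (by norm_num)
    have h2 : (2 : ℝ) ≤ #D' := by linarith
    exact_mod_cast h2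
  rcases pivot_trichotomy (p := p) hBne hL2 hL0 (H := q ^ 4852) (by positivity)
    (by
      have h1 : q ^ 4852 ≤ q ^ 6409 := pow_le_pow_right₀ hq1 (by norm_num)
      linarith)
    (fun a ha b hb c hc d hd e he f hf =>
      (card_pivotSet_le hBne hk0 hτ0 hBB hL0 (fun l hl => by
        obtain ⟨l', hl', rfl⟩ := mem_image.1 hl
        exact hBl l' hl') ha hb hc hd he hf).trans (by gcongr)) with h1 | h1 | ⟨h1, h2⟩
  -- The alternative that L is small fails because 2 · 6361 = 12722 exceeds 11272.
  · exfalso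
    rw [hLc] at h1
    have h3 : q ^ 12722 ≤ q ^ 11272 :=
      calc q ^ 12722 = (q ^ 6361) ^ 2 := by ring
        _ ≤ (#D' : ℝ) ^ 2 := by gcongr
        _ ≤ _ := h1.trans hup'
    have h4 : q ^ 11272 < q ^ 12722 := pow_lt_pow_right₀ (by linarith) (by norm_num)
    linarith
  · exact Or.inl (h1.trans hup)
  · refine Or.inr ⟨h1.trans hup', D', hD', hD'c, fun a ha b hb c hc d hd hcd => ?_⟩
    have h3 := h2 _ (mem_image_of_mem _ ha) _ (mem_image_of_mem _ hb) _ (mem_image_of_mem _ hc) _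
      (mem_image_of_mem _ hd) fun h => hcd (hdivinj h)
    rwa [← sub_div, ← sub_div, div_div_div_cancel_right₀ hl₀0] at h3

open Finset in
/-- **Pencil theorem.** Consider points with coordinates `u`, `w` and dense sets `S a` of points on
which `u - a * w` takes few values. Either the field is small, or many of the parameters `a` are
mapped to the prime subfield by a single Möbius transformation. -/
theorem exists_mobius_mem_bot {F α : Type*} [Field F] [Finite F] [DecidableEq F] [DecidableEq α]
    {p : ℕ} [Fact p.Prime] [CharP F p] {q : ℝ} (hq : 2 ^ 11 ≤ q) {D : Finset F}
    (hD : q ^ 6418 ≤ #D) {T : Finset α} (hT : (#T : ℝ) ≤ (2 * q ^ 6419) ^ 2) {S : F → Finset α}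
    (hST : ∀ a ∈ D, S a ⊆ T) (hS : ∀ a ∈ D, (2 * q ^ 6419) ^ 2 / (4 * q ^ 2) ≤ #(S a))
    (u w : α → F) (huw : ∀ x ∈ T, ∀ y ∈ T, u x = u y → w x = w y → x = y)
    (himg : ∀ a ∈ D, (#((S a).image fun x => u x - a * w x) : ℝ) ≤ 2 * q ^ 6419) :
    (p : ℝ) ^ 2 ≤ q ^ 11272 ∨ ((p : ℝ) ≤ q ^ 11272 ∧ ∃ D' ⊆ D, q ^ 6361 ≤ #D' ∧
      ∃ r s b : F, r * b + s ≠ 0 ∧ b ∉ D' ∧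
        ∀ a ∈ D', (r * a + s) / (a - b) ∈ (⊥ : Subfield F)) := by
  have hq0 : 0 < q := by linarith
  have hq1 : 1 ≤ q := by linarith
  obtain ⟨a₁, ha₁, a₂, ha₂, h12, D₁, hD₁, h1D, h2D, hD₁c, hinter⟩ :=
    exists_pair_many_large_inter hq (by positivity) hD hT hST hS
  have h12' : a₁ - a₂ ≠ 0 := sub_ne_zero.2 h12
  have hne1 : ∀ a ∈ D₁, a₁ - a ≠ 0 := fun a ha => sub_ne_zero.2 fun h => h1D (h ▸ ha)
  have hne2 : ∀ a ∈ D₁, a - a₂ ≠ 0 := fun a ha => sub_ne_zero.2 fun h => h2D (h ▸ ha)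
  -- With X = u - a₁ w and Y = u - a₂ w, the sum X + lam a * Y is a nonzero multiple of u - a w. The
  -- map `phi` inverts `lam`.
  set lam : F → F := fun a => (a₁ - a) / (a - a₂) with hlam
  set phi : F → F := fun l => (a₁ + l * a₂) / (1 + l) with hphi
  have hphilam : ∀ a ∈ D₁, phi (lam a) = a := by
    intro a ha
    have h0 := hne2 a ha
    simp only [hphi, hlam]
    have h3 : 1 + (a₁ - a) / (a - a₂) = (a₁ - a₂) / (a - a₂) := by field_simp; ring
    rw [h3, div_eq_iff (div_ne_zero h12' h0)]
    field_simp
    ring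
  have hlaminj : Set.InjOn lam D₁ := fun a ha b hb hab => by
    rw [← hphilam a ha, hab, hphilam b hb]
  set E := D₁.image lam with hE
  have hEc : #E = #D₁ := card_image_of_injOn hlaminj
  set R : F → Finset α := fun a => (S a ∩ S a₁) ∩ (S a₂ ∩ S a₁) with hR
  set G : F → Finset (F × F) := fun l =>
    (R (phi l)).image fun x => (u x - a₁ * w x, u x - a₂ * w x) with hG
  have hRT : ∀ a, R a ⊆ T := fun a =>
    inter_subset_right.trans (inter_subset_left.trans (hST a₂ ha₂))
  have hmain := exists_ratios_mem_bot (p := p) hq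
    ((S a₁).image fun x => u x - a₁ * w x) ((S a₂).image fun x => u x - a₂ * w x) E
    (by rw [hEc]; exact hD₁c)
    (by
      intro l hl
      obtain ⟨a, ha, rfl⟩ := mem_image.1 hl
      exact div_ne_zero (hne1 a ha) (hne2 a ha))
    G
    (by
      intro l _ z hz
      obtain ⟨x, hx, rfl⟩ := mem_image.1 hz
      have hx' := mem_inter.1 (mem_inter.1 hx).2
      exact mem_product.2 ⟨mem_image_of_mem (fun x => u x - a₁ * w x) hx'.2,
        mem_image_of_mem (fun x => u x - a₂ * w x) hx'.1⟩)
    (himg a₁ ha₁) (himg a₂ ha₂)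
    (by
      intro l hl
      obtain ⟨a, ha, rfl⟩ := mem_image.1 hl
      simp only [hG]
      rw [card_image_of_injOn]
      · rw [hphilam a ha]
        exact hinter a ha
      · intro x hx y hy hxy
        simp only [Prod.mk.injEq] at hxy
        have hw : w x = w y := by
          refine mul_left_cancel₀ h12' ?_
          linear_combination hxy.2 - hxy.1
        refine huw x (hRT _ hx) y (hRT _ hy) ?_ hw
        have := hxy.1
        rw [hw] at this
        exact sub_left_injective this)
    (by
      intro l hl
      obtain ⟨a, ha, rfl⟩ := mem_image.1 hl
      refine le_trans (Nat.cast_le.2 ?_) (himg a (hD₁ ha))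
      simp only [hG]
      rw [image_image, hphilam a ha]
      have h3 : (R a).image ((fun z : F × F => z.1 + lam a * z.2) ∘
          fun x => (u x - a₁ * w x, u x - a₂ * w x)) ⊆
          ((S a).image fun x => u x - a * w x).image
            fun v => (a₁ - a₂) / (a - a₂) * v := by
        intro v hv
        obtain ⟨x, hx, rfl⟩ := mem_image.1 hv
        refine mem_image.2 ⟨u x - a * w x, mem_image_of_mem _
          (mem_inter.1 (mem_inter.1 hx).1).1, ?_⟩
        have h0 := hne2 a ha
        simp only [hlam, Function.comp]
        field_simp
        ring
      exact (card_le_card h3).trans card_image_le)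
  rcases hmain with h | ⟨hp, E', hE', hE'c, hratio⟩
  · exact Or.inl h
  refine Or.inr ⟨hp, E'.image phi, ?_, ?_, ?_⟩
  · intro a ha
    obtain ⟨l, hl, rfl⟩ := mem_image.1 ha
    obtain ⟨a', ha', rfl⟩ := mem_image.1 (hE' hl)
    rw [hphilam a' ha']
    exact hD₁ ha'
  · rw [card_image_of_injOn]
    · exact hE'c
    · intro l hl l' hl' heq
      obtain ⟨a, ha, rfl⟩ := mem_image.1 (hE' hl)
      obtain ⟨a', ha', rfl⟩ := mem_image.1 (hE' hl')
      rw [hphilam a ha, hphilam a' ha'] at heq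
      rw [heq]
  · have h2 : 1 < #E' := by
      have h1 : q ^ 1 ≤ q ^ 6361 := pow_le_pow_right₀ hq1 (by norm_num)
      have h2 : (1 : ℝ) < #E' := by linarith
      exact_mod_cast h2
    obtain ⟨l₁, hl₁, l₂, hl₂, hl⟩ := one_lt_card.1 h2
    have hl0 : l₂ - l₁ ≠ 0 := sub_ne_zero.2 hl.symm
    -- These coefficients write the ratio (lam a - l₁)/(l₂ - l₁) as a Möbius map of a with pole a₂.
    refine ⟨(-1 - l₁) / (l₂ - l₁), (a₁ + l₁ * a₂) / (l₂ - l₁), a₂, ?_, ?_, ?_⟩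
    · have : (-1 - l₁) / (l₂ - l₁) * a₂ + (a₁ + l₁ * a₂) / (l₂ - l₁) = (a₁ - a₂) / (l₂ - l₁) := by
        field_simp
        ring
      rw [this]
      exact div_ne_zero h12' hl0
    · intro ha
      obtain ⟨l, hl, h⟩ := mem_image.1 ha
      obtain ⟨a, ha, rfl⟩ := mem_image.1 (hE' hl)
      rw [hphilam a ha] at h
      exact h2D (h ▸ ha)
    · intro a ha
      obtain ⟨l, hl', rfl⟩ := mem_image.1 ha
      have h3 := hratio l hl' l₁ hl₁ l₂ hl₂ l₁ hl₁ hl.symm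
      obtain ⟨a', ha', rfl⟩ := mem_image.1 (hE' hl')
      rw [hphilam a' ha']
      have h0 := hne2 a' ha'
      convert h3 using 1
      simp only [hlam]
      field_simp
      ring

/-! ### Pruning the incidence graph -/

open Finset in
/-- A bipartite graph with more than `c (#P + #L)` edges has a nonempty induced subgraph of minimum
degree at least `c`. -/
theorem exists_subsets_min_degree {α β : Type*} [DecidableEq α] [DecidableEq β]
    (r : α → β → Prop) [∀ a b, Decidable (r a b)] (P : Finset α) (L : Finset β) {c : ℝ}
    (hc : 0 ≤ c) (h : c * (#P + #L) < ∑ x ∈ P, (#{l ∈ L | r x l} : ℝ)) :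
    ∃ P' ⊆ P, ∃ L' ⊆ L, P'.Nonempty ∧ (∀ x ∈ P', c ≤ #{l ∈ L' | r x l}) ∧
      ∀ l ∈ L', c ≤ #{x ∈ P' | r x l} := by
  have hswap : ∀ (P : Finset α) (L : Finset β), ∑ x ∈ P, (#{l ∈ L | r x l} : ℝ) =
      ∑ l ∈ L, (#{x ∈ P | r x l} : ℝ) := fun P L => by
    exact_mod_cast sum_card_bipartiteAbove_eq_sum_card_bipartiteBelow r
  -- At a maximiser of edges minus c times vertices, deleting a vertex of degree below c would
  -- increase f. The maximum is positive by hypothesis, hence not attained with P' empty.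
  set f : Finset α × Finset β → ℝ := fun z =>
    ∑ x ∈ z.1, (#{l ∈ z.2 | r x l} : ℝ) - c * (#z.1 + #z.2) with hf
  obtain ⟨⟨P', L'⟩, hz, hmax⟩ := exists_max_image (P.powerset ×ˢ L.powerset) f
    ⟨(P, L), by simp⟩
  simp only [mem_product, mem_powerset] at hz
  have hpos : 0 < f (P', L') := lt_of_lt_of_le (by simp only [hf]; linarith)
    (hmax (P, L) (by simp))
  refine ⟨P', hz.1, L', hz.2, ?_, ?_, ?_⟩
  · rw [nonempty_iff_ne_empty]
    rintro rfl
    simp only [hf, sum_empty, card_empty, Nat.cast_zero, zero_add, zero_sub] at hpos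
    have : 0 ≤ c * (#L' : ℝ) := by positivity
    linarith
  · intro x hx
    have h1 := hmax (P'.erase x, L') (by
      simp only [mem_product, mem_powerset]
      exact ⟨(erase_subset _ _).trans hz.1, hz.2⟩)
    simp only [hf] at h1
    rw [← add_sum_erase P' _ hx, ← card_erase_add_one hx] at h1
    push_cast at h1
    linarith
  · intro l hl
    have h1 := hmax (P', L'.erase l) (by
      simp only [mem_product, mem_powerset]
      exact ⟨hz.1, (erase_subset _ _).trans hz.2⟩)
    simp only [hf] at h1
    rw [hswap, hswap, ← add_sum_erase L' _ hl, ← card_erase_add_one hl] at h1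
    push_cast at h1
    linarith

open Finset in
/-- Points lying on many lines contribute few incidences, if two points lie on at most one line. -/
theorem sum_degree_le_of_le_degree {α β : Type*} [DecidableEq α] [DecidableEq β]
    (r : α → β → Prop) [∀ a b, Decidable (r a b)] (P : Finset α) (L : Finset β) {M : ℝ}
    (hM : 0 ≤ M) (hL : 4 * (#L : ℝ) ≤ M ^ 2)
    (hr : ∀ x ∈ P, ∀ y ∈ P, x ≠ y → #{l ∈ L | r x l ∧ r y l} ≤ 1)
    (hdeg : ∀ x ∈ P, M ≤ #{l ∈ L | r x l}) :
    ∑ x ∈ P, (#{l ∈ L | r x l} : ℝ) ≤ 2 * #L := by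
  set I := ∑ x ∈ P, (#{l ∈ L | r x l} : ℝ) with hI
  have hswap : I = ∑ l ∈ L, (#{x ∈ P | r x l} : ℝ) := by
    rw [hI]
    exact_mod_cast sum_card_bipartiteAbove_eq_sum_card_bipartiteBelow r
  have hsq : ∑ l ∈ L, (#{x ∈ P | r x l} : ℝ) ^ 2 ≤ I + #P * #P := by
    have h1 : ∑ l ∈ L, #{x ∈ P | r x l} ^ 2 =
        ∑ z ∈ P ×ˢ P, #{l ∈ L | r z.1 l ∧ r z.2 l} := by
      have h2 := sum_card_bipartiteAbove_eq_sum_card_bipartiteBelow (s := P ×ˢ P) (t := L)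
        (fun z l => r z.1 l ∧ r z.2 l)
      simp only [bipartiteAbove, bipartiteBelow] at h2
      rw [h2]
      refine sum_congr rfl fun l _ => ?_
      rw [sq, ← card_product]
      congr 1
      ext ⟨x, y⟩
      simp only [mem_filter, mem_product]
      tauto
    have h3 : ∑ z ∈ P ×ˢ P, #{l ∈ L | r z.1 l ∧ r z.2 l} ≤
        ∑ x ∈ P, (#{l ∈ L | r x l} + #P) := by
      rw [sum_product]
      refine sum_le_sum fun x hx => ?_
      rw [← add_sum_erase P _ hx]
      refine add_le_add (le_of_eq (by simp only [and_self])) ?_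
      refine (sum_le_card_nsmul _ _ 1 fun y hy => ?_).trans ?_
      · exact hr x hx y (mem_erase.1 hy).2 (mem_erase.1 hy).1.symm
      · rw [smul_eq_mul, mul_one]
        exact card_erase_le
    rw [sum_add_distrib, sum_const, smul_eq_mul] at h3
    have h4 := h1.trans_le h3
    rw [hI]
    exact_mod_cast h4
  have hI0 : 0 ≤ I := sum_nonneg fun _ _ => by positivity
  have hPM : #P * M ≤ I := by
    rw [← nsmul_eq_mul]
    exact card_nsmul_le_sum _ _ _ hdeg
  have hcs : I ^ 2 ≤ #L * ∑ l ∈ L, (#{x ∈ P | r x l} : ℝ) ^ 2 := by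
    rw [hswap]
    exact sq_sum_le_card_mul_sum_sq
  -- With 4|L||P|² ≤ I² this reads I² ≤ |L| I + I²/4.
  have h1 : I ^ 2 ≤ #L * (I + #P * #P) := hcs.trans (by gcongr)
  have h2 : 4 * (#L : ℝ) * (#P * #P) ≤ I ^ 2 :=
    calc 4 * (#L : ℝ) * (#P * #P) ≤ M ^ 2 * (#P * #P) := by gcongr
      _ = (#P * M) ^ 2 := by ring
      _ ≤ I ^ 2 := by gcongr
  by_contra! hcon
  have hL0 : (0 : ℝ) ≤ #L := by positivity
  nlinarith

/-! ### Lines of the affine plane -/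

namespace IsPlaneLine

variable {F : Type*} [Field F] {l l' : AffineSubspace F (F × F)}

theorem exists_eq (hl : IsPlaneLine l) :
    (∃ m b : F, ∀ z : F × F, z ∈ l ↔ z.2 = m * z.1 + b) ∨
      ∃ a : F, ∀ z : F × F, z ∈ l ↔ z.1 = a := by
  have hne : (l : Set (F × F)).Nonempty := by
    rw [Set.nonempty_iff_ne_empty]
    intro h
    rw [AffineSubspace.coe_eq_bot_iff] at h
    rw [IsPlaneLine, h, AffineSubspace.direction_bot, finrank_bot] at hl
    exact zero_ne_one hl
  obtain ⟨z₀, hz₀⟩ := hne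
  obtain ⟨v, hv0, hv⟩ := finrank_eq_one_iff'.1 hl
  have hmem : ∀ z : F × F, z ∈ l ↔ ∃ c : F, c • (v : F × F) = z - z₀ := by
    intro z
    rw [← AffineSubspace.vsub_right_mem_direction_iff_mem hz₀ z, vsub_eq_sub]
    constructor
    · intro h
      obtain ⟨c, hc⟩ := hv ⟨_, h⟩
      exact ⟨c, congrArg Subtype.val hc⟩
    · rintro ⟨c, hc⟩
      rw [← hc]
      exact l.direction.smul_mem c v.2
  obtain ⟨⟨v₁, v₂⟩, hvl⟩ := v
  have hv0' : ¬(v₁ = 0 ∧ v₂ = 0) := by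
    rintro ⟨rfl, rfl⟩
    exact hv0 rfl
  by_cases h1 : v₁ = 0
  · right
    have h2 : v₂ ≠ 0 := fun h => hv0' ⟨h1, h⟩
    refine ⟨z₀.1, fun z => ?_⟩
    rw [hmem]
    constructor
    · rintro ⟨c, hc⟩
      have := congrArg Prod.fst hc
      simp only [h1, Prod.smul_fst, smul_eq_mul, mul_zero, Prod.fst_sub] at this
      exact (sub_eq_zero.1 this.symm)
    · intro h
      refine ⟨(z.2 - z₀.2) / v₂, ?_⟩
      ext
      · simp [h1, h]
      · simp [h2]
  · left
    refine ⟨v₂ / v₁, z₀.2 - v₂ / v₁ * z₀.1, fun z => ?_⟩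
    rw [hmem]
    constructor
    · rintro ⟨c, hc⟩
      have e1 := congrArg Prod.fst hc
      have e2 := congrArg Prod.snd hc
      simp only [Prod.smul_fst, Prod.smul_snd, smul_eq_mul, Prod.fst_sub, Prod.snd_sub] at e1 e2
      field_simp
      linear_combination v₂ * e1 - v₁ * e2
    · intro h
      refine ⟨(z.1 - z₀.1) / v₁, ?_⟩
      ext
      · simp [h1]
      · simp only [Prod.smul_snd, smul_eq_mul, Prod.snd_sub]
        rw [h]
        field_simp
        ring

theorem eq_of_mem_of_mem (hl : IsPlaneLine l) (hl' : IsPlaneLine l') {x y : F × F} (hxy : x ≠ y)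
    (hx : x ∈ l) (hy : y ∈ l) (hx' : x ∈ l') (hy' : y ∈ l') : l = l' := by
  obtain ⟨x₁, x₂⟩ := x
  obtain ⟨y₁, y₂⟩ := y
  rcases hl.exists_eq with ⟨m, b, h⟩ | ⟨a, h⟩ <;> rcases hl'.exists_eq with ⟨m', b', h'⟩ | ⟨a', h'⟩
  all_goals
    rw [h] at hx hy
    rw [h'] at hx' hy'
    simp only at hx hy hx' hy'
  · have hne : x₁ - y₁ ≠ 0 := by
      refine sub_ne_zero.2 fun he => hxy ?_
      rw [hx, hy, he]
    have hm : m = m' := by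
      refine mul_right_cancel₀ hne ?_
      linear_combination hx' - hx + hy - hy'
    have hb : b = b' := by
      rw [← hm] at hx'
      linear_combination hx' - hx
    ext z
    rw [h, h', hm, hb]
  · exact absurd (by rw [hx, hy, hx', hy']) hxy
  · exact absurd (by rw [hx', hy', hx, hy]) hxy
  · ext z
    rw [h, h', ← hx, ← hx']

theorem exists_slope_of_ne (hl : IsPlaneLine l) (hl' : IsPlaneLine l') {x : F × F}
    (hx : x ∈ l) (hx' : x ∈ l') (hne : l ≠ l') :
    (∃ m b : F, ∀ z : F × F, z ∈ l ↔ z.2 = m * z.1 + b) ∨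
      ∃ m b : F, ∀ z : F × F, z ∈ l' ↔ z.2 = m * z.1 + b := by
  rcases hl.exists_eq with h | ⟨a, h⟩
  · exact Or.inl h
  rcases hl'.exists_eq with h' | ⟨a', h'⟩
  · exact Or.inr h'
  refine absurd ?_ hne
  rw [h] at hx
  rw [h'] at hx'
  ext z
  rw [h, h', ← hx, ← hx']

/-- The projective coordinate `(x - a) / (y - m x - b)` is constant along a line through the point
`(a, m a + b)`. -/
theorem div_eq_div (hl : IsPlaneLine l) {m b a : F} (ha : (a, m * a + b) ∈ l) {x y : F × F}
    (hx : x ∈ l) (hy : y ∈ l) (hx0 : x.2 - m * x.1 - b ≠ 0) (hy0 : y.2 - m * y.1 - b ≠ 0) :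
    (x.1 - a) / (x.2 - m * x.1 - b) = (y.1 - a) / (y.2 - m * y.1 - b) := by
  rw [div_eq_div_iff hx0 hy0]
  rcases hl.exists_eq with ⟨m', b', h⟩ | ⟨a', h⟩
  · rw [h] at ha hx hy
    simp only at ha
    rw [hx, hy]
    linear_combination (y.1 - x.1) * ha
  · rw [h] at ha hx hy
    simp only at ha
    rw [hx, hy, ← ha]
    ring

end IsPlaneLine

/-! ### From incidences to pencils -/

open Finset in
theorem incidences_eq_sum {F : Type*} [Field F] (P : Finset (F × F))
    (L : Finset (AffineSubspace F (F × F))) [∀ (x : F × F) (l : AffineSubspace F (F × F)),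
      Decidable (x ∈ l)] :
    (incidences P L : ℝ) = ∑ x ∈ P, (#{l ∈ L | x ∈ l} : ℝ) := by
  classical
  have : incidences P L = ∑ x ∈ P, #{l ∈ L | x ∈ l} := by
    simp only [incidences, Finset.card_filter, Finset.sum_product]
    exact Finset.sum_congr rfl fun _ _ => Finset.sum_congr rfl fun _ _ => by congr
  exact_mod_cast this

theorem incidences_le {F : Type*} [Field F] (P : Finset (F × F))
    (L : Finset (AffineSubspace F (F × F))) : incidences P L ≤ P.card * L.card := by
  classical
  rw [← Finset.card_product]
  exact Finset.card_filter_le _ _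

open Finset in
/-- Many incidences produce a nonvertical line on which there are many points, each of which lies on
few lines, which nevertheless cover many points of `P`. The pencil theorem then applies. -/
theorem exists_mobius_mem_bot_of_incidences {F : Type*} [Field F] [Finite F] {p : ℕ}
    [Fact p.Prime] [CharP F p] {q : ℝ} (hq : 2 ^ 11 ≤ q) {P : Finset (F × F)}
    {L : Finset (AffineSubspace F (F × F))} (hP : (#P : ℝ) = q ^ 12838)
    (hL : (#L : ℝ) = q ^ 12838) (hline : ∀ l ∈ L, IsPlaneLine l)
    (hI : 16 * q ^ 19256 < incidences P L) :
    ∃ D ⊆ xProj P, q ^ 6418 ≤ #D ∧ ((p : ℝ) ^ 2 ≤ q ^ 11272 ∨ ((p : ℝ) ≤ q ^ 11272 ∧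
      ∃ D' ⊆ D, q ^ 6361 ≤ #D' ∧ ∃ r s b : F, r * b + s ≠ 0 ∧ b ∉ D' ∧
        ∀ a ∈ D', (r * a + s) / (a - b) ∈ (⊥ : Subfield F))) := by
  classical
  have hq0 : 0 < q := by linarith
  have hq1 : 1 ≤ q := by linarith
  have hqc : 1 ≤ q ^ 6418 := one_le_pow₀ hq1
  rw [incidences_eq_sum, ← sum_filter_add_sum_filter_not P
    (fun x => 2 * q ^ 6419 ≤ (#{l ∈ L | x ∈ l} : ℝ))] at hI
  set P₁ : Finset (F × F) := {x ∈ P | ¬2 * q ^ 6419 ≤ (#{l ∈ L | x ∈ l} : ℝ)} with hP₁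
  -- The threshold 2 q^6419 = 2√n is the least M with 4|L| ≤ M².
  have hhigh := sum_degree_le_of_le_degree (fun x l => x ∈ l)
    {x ∈ P | 2 * q ^ 6419 ≤ (#{l ∈ L | x ∈ l} : ℝ)} L (M := 2 * q ^ 6419) (by positivity)
    (by rw [hL]; exact le_of_eq (by ring))
    (fun x _ y _ hxy => card_le_one.2 fun l hl l' hl' => by
      obtain ⟨h1, h2, h3⟩ := mem_filter.1 hl
      obtain ⟨h1', h2', h3'⟩ := mem_filter.1 hl'
      exact (hline l h1).eq_of_mem_of_mem (hline l' h1') hxy h2 h3 h2' h3')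
    (fun x hx => (mem_filter.1 hx).2)
  have hlow : 2 * q ^ 6418 * (#P₁ + #L) < ∑ x ∈ P₁, (#{l ∈ L | x ∈ l} : ℝ) := by
    have h1 : 2 * q ^ 6418 * (#P₁ + #L) ≤ 2 * q ^ 6418 * (q ^ 12838 + q ^ 12838) := by
      have : (#P₁ : ℝ) ≤ #P := by exact_mod_cast card_filter_le _ _
      rw [← hP, hL]
      rw [← hP]
      gcongr
    have h2 : 2 * q ^ 6418 * (q ^ 12838 + q ^ 12838) = 4 * q ^ 19256 := by ring
    have h3 : q ^ 12838 ≤ q ^ 19256 := pow_le_pow_right₀ hq1 (by norm_num)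
    rw [hL] at hhigh
    have h4 : 0 < q ^ 19256 := by positivity
    linarith
  obtain ⟨P₂, hP₂, L₂, hL₂, ⟨x₀, hx₀⟩, hdegP, hdegL⟩ := exists_subsets_min_degree
    (fun (x : F × F) (l : AffineSubspace F (F × F)) => x ∈ l) P₁ L
    (c := 2 * q ^ 6418) (by positivity) hlow
  have hP₂P : P₂ ⊆ P := hP₂.trans (filter_subset _ _)
  have hline₂ : ∀ l ∈ L₂, IsPlaneLine l := fun l hl => hline l (hL₂ hl)
  -- Of two distinct lines through x₀, at most one is vertical.
  obtain ⟨l₀, hl₀, m, b, hmb⟩ : ∃ l₀ ∈ L₂, ∃ m b : F, ∀ z : F × F, z ∈ l₀ ↔ z.2 = m * z.1 + b := by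
    have h1 : 1 < #{l ∈ L₂ | x₀ ∈ l} := by
      have h2 : (1 : ℝ) < #{l ∈ L₂ | x₀ ∈ l} := by linarith [hdegP x₀ hx₀]
      exact_mod_cast h2
    obtain ⟨l, hl, l', hl', hne⟩ := one_lt_card.1 h1
    obtain ⟨h2, h3⟩ := mem_filter.1 hl
    obtain ⟨h2', h3'⟩ := mem_filter.1 hl'
    rcases (hline₂ l h2).exists_slope_of_ne (hline₂ l' h2') h3 h3' hne with h | h
    · exact ⟨l, h2, h⟩
    · exact ⟨l', h2', h⟩
  set D : Finset F := {x ∈ P₂ | x ∈ l₀}.image Prod.fst with hD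
  set T : Finset (F × F) := {x ∈ P₂ | x ∉ l₀} with hT
  set Ls : F → Finset (AffineSubspace F (F × F)) := fun a =>
    {l ∈ L₂ | (a, m * a + b) ∈ l}.erase l₀ with hLs
  set S : F → Finset (F × F) := fun a => (Ls a).biUnion fun l => {x ∈ T | x ∈ l} with hS
  have hbase : ∀ a : F, (a, m * a + b) ∈ l₀ := fun a => (hmb _).2 rfl
  have hDP : ∀ a ∈ D, (a, m * a + b) ∈ P₂ := by
    intro a ha
    obtain ⟨⟨x, y⟩, hxy, rfl⟩ := mem_image.1 ha
    obtain ⟨h1, h2⟩ := mem_filter.1 hxy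
    rw [hmb] at h2
    simp only at h2 ⊢
    rwa [← h2]
  have hDc : q ^ 6418 ≤ #D := by
    rw [hD, card_image_of_injOn]
    · linarith [hdegL l₀ hl₀]
    · rintro ⟨x, y⟩ hx ⟨x', y'⟩ hx' heq
      have h1 := (hmb _).1 (mem_filter.1 hx).2
      have h2 := (hmb _).1 (mem_filter.1 hx').2
      simp only at heq h1 h2
      rw [h1, h2, heq]
  have hDx : D ⊆ xProj P := by
    intro a ha
    obtain ⟨x, hx, rfl⟩ := mem_image.1 ha
    simp only [xProj]
    exact mem_image_of_mem _ (hP₂P (mem_filter.1 hx).1)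
  have hLs_mem : ∀ a, ∀ l ∈ Ls a, l ≠ l₀ ∧ l ∈ L₂ ∧ (a, m * a + b) ∈ l := by
    intro a l hl
    obtain ⟨h1, h2⟩ := mem_erase.1 hl
    exact ⟨h1, mem_filter.1 h2⟩
  -- Degree 2 q^6418 leaves q^6418 after removing l₀ itself; the same slack pays below for the base
  -- point on each line.
  have hLs_ge : ∀ a ∈ D, q ^ 6418 ≤ #(Ls a) := by
    intro a ha
    have h1 := hdegP _ (hDP a ha)
    rw [← card_erase_add_one (s := {l ∈ L₂ | (a, m * a + b) ∈ l})
      (mem_filter.2 ⟨hl₀, hbase a⟩)] at h1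
    push_cast at h1
    simp only [hLs]
    linarith
  have hLs_le : ∀ a ∈ D, (#(Ls a) : ℝ) ≤ 2 * q ^ 6419 := by
    intro a ha
    have h1 := (mem_filter.1 (hP₂ (hDP a ha))).2
    have h2 : #(Ls a) ≤ #{l ∈ L | (a, m * a + b) ∈ l} :=
      card_le_card ((erase_subset _ _).trans (filter_subset_filter _ hL₂))
    exact le_trans (by exact_mod_cast h2) (not_le.1 h1).le
  have hpts : ∀ a, ∀ l ∈ Ls a, q ^ 6418 ≤ #{x ∈ T | x ∈ l} := by
    intro a l hl
    obtain ⟨h1, h2, h3⟩ := hLs_mem a l hl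
    have h4 : {x ∈ P₂ | x ∈ l} ⊆ insert (a, m * a + b) {x ∈ T | x ∈ l} := by
      intro x hx
      obtain ⟨hx1, hx2⟩ := mem_filter.1 hx
      by_cases hxa : x = (a, m * a + b)
      · rw [hxa]
        exact mem_insert_self _ _
      · refine mem_insert_of_mem (mem_filter.2 ⟨mem_filter.2 ⟨hx1, fun hx0 => h1 ?_⟩, hx2⟩)
        exact (hline₂ l h2).eq_of_mem_of_mem (hline₂ l₀ hl₀) hxa hx2 h3 hx0 (hbase a)
    have h5 : (#{x ∈ P₂ | x ∈ l} : ℝ) ≤ #{x ∈ T | x ∈ l} + 1 := by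
      exact_mod_cast (card_le_card h4).trans (card_insert_le _ _)
    linarith [hdegL l h2]
  -- Lines of a pencil meet only at their base point, which lies on l₀ and hence outside T, so their
  -- point counts add up.
  have hScard : ∀ a ∈ D, (2 * q ^ 6419) ^ 2 / (4 * q ^ 2) ≤ #(S a) := by
    intro a ha
    have h1 : #(S a) = ∑ l ∈ Ls a, #{x ∈ T | x ∈ l} := by
      refine card_biUnion fun l hl l' hl' hne => disjoint_left.2 fun x hx hx' => hne ?_
      obtain ⟨h1, h2, h3⟩ := hLs_mem a l hl
      obtain ⟨h1', h2', h3'⟩ := hLs_mem a l' hl'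
      obtain ⟨hxT, hxl⟩ := mem_filter.1 hx
      have hxl' := (mem_filter.1 hx').2
      refine (hline₂ l h2).eq_of_mem_of_mem (hline₂ l' h2') (fun he => ?_) hxl h3 hxl' h3'
      exact (mem_filter.1 hxT).2 (he ▸ hbase a)
    have h2 : #(Ls a) • q ^ 6418 ≤ ∑ l ∈ Ls a, (#{x ∈ T | x ∈ l} : ℝ) :=
      card_nsmul_le_sum _ _ _ fun l hl => hpts a l hl
    have h3 : (#(S a) : ℝ) = ∑ l ∈ Ls a, (#{x ∈ T | x ∈ l} : ℝ) := by exact_mod_cast h1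
    rw [h3]
    refine le_trans ?_ h2
    rw [nsmul_eq_mul, div_le_iff₀ (by positivity)]
    calc (2 * q ^ 6419) ^ 2 = q ^ 6418 * q ^ 6418 * (4 * q ^ 2) := by ring
      _ ≤ #(Ls a) * q ^ 6418 * (4 * q ^ 2) := by
        gcongr
        exact hLs_ge a ha
  have hne0 : ∀ x ∈ T, x.2 - m * x.1 - b ≠ 0 := by
    intro x hx h
    refine (mem_filter.1 hx).2 ((hmb x).2 ?_)
    linear_combination h
  -- These are affine coordinates after l₀ is sent to infinity. By `div_eq_div`, u - a w is constant
  -- on each line through (a, m a + b), so it takes at most as many values as the pencil has lines.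
  refine ⟨D, hDx, hDc, exists_mobius_mem_bot hq hDc (T := T) ?_ (S := S) ?_ hScard
    (fun x => x.1 / (x.2 - m * x.1 - b)) (fun x => 1 / (x.2 - m * x.1 - b)) ?_ ?_⟩
  · have h1 : (#T : ℝ) ≤ #P := by exact_mod_cast card_le_card ((filter_subset _ _).trans hP₂P)
    rw [hP] at h1
    refine h1.trans ?_
    have h2 : (2 * q ^ 6419) ^ 2 = 4 * q ^ 12838 := by ring
    have h3 : 0 ≤ q ^ 12838 := by positivity
    linarith
  · intro a _ x hx
    obtain ⟨l, _, hx⟩ := mem_biUnion.1 hx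
    exact (mem_filter.1 hx).1
  · rintro ⟨x₁, x₂⟩ hx ⟨y₁, y₂⟩ hy hu hw
    have h1 := hne0 _ hx
    have h2 := hne0 _ hy
    simp only at hu hw h1 h2
    have h3 : x₂ - m * x₁ - b = y₂ - m * y₁ - b := by
      rw [one_div, one_div] at hw
      exact inv_injective hw
    rw [h3] at hu
    have h4 : x₁ = y₁ := (div_left_inj' h2).1 hu
    subst h4
    have h5 : x₂ = y₂ := by linear_combination h3
    rw [h5]
  · intro a ha
    refine le_trans (Nat.cast_le.2 ?_) (hLs_le a ha)
    simp only [hS]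
    rw [biUnion_image]
    refine (card_biUnion_le_card_mul _ _ 1 fun l hl => ?_).trans (by rw [mul_one])
    refine card_le_one.2 fun v hv v' hv' => ?_
    obtain ⟨x, hx, rfl⟩ := mem_image.1 hv
    obtain ⟨y, hy, rfl⟩ := mem_image.1 hv'
    obtain ⟨hxT, hxl⟩ := mem_filter.1 hx
    obtain ⟨hyT, hyl⟩ := mem_filter.1 hy
    obtain ⟨-, h2, h3⟩ := hLs_mem a l hl
    have := (hline₂ l h2).div_eq_div h3 hxl hyl (hne0 x hxT) (hne0 y hyT)
    rw [sub_div, sub_div] at this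
    rw [mul_one_div, mul_one_div]
    exact this

/-! ### Conclusion: choice of constants and comparison of exponents -/

theorem IsDefiningElement.notMem_bot {F : Type*} [Field F] {p : ℕ} [Fact p.Prime] [CharP F p]
    (hF : Nat.card F = p ^ 2) {t : F} (ht : IsDefiningElement t) : t ∉ (⊥ : Subfield F) := by
  intro h
  have htop : (⊥ : Subfield F) = ⊤ := by
    refine top_unique fun x _ => ?_
    obtain ⟨a, ha, b, hb, rfl⟩ := ht x
    exact add_mem ha (mul_mem h hb)
  have h1 := Subfield.card_bot F p
  rw [htop, Nat.card_congr (Subfield.topEquiv (K := F)).toEquiv, hF] at h1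
  have := (Fact.out : p.Prime).two_le
  nlinarith

theorem mainTheorem2 (C₁ C₂ C₃ : ℝ) :
    ∃ K : ℝ, ∀ (p : ℕ), p.Prime →
      ∀ (F : Type*) [Field F] [Finite F], Nat.card F = p ^ 2 →
      ∀ t : F, IsDefiningElement t →
      ∀ (n : ℕ) (P : Finset (F × F)), P.card = n →
      ((xProj P).card : ℝ) ≤ C₁ * (p : ℝ) →
      ∀ (J : Finset F) (A : F → Finset F),
        (∀ j ∈ J, j ∈ (⊥ : Subfield F)) →
        (xProj P : Set F) = ⋃ j ∈ J, (A j : Set F) →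
        (J.card : ℝ) ≤ C₂ * max ((p : ℝ) ^ (1 / 2 : ℝ)) ((n : ℝ) ^ (2560 / 6419 : ℝ)) →
        (∀ j ∈ J, (A j : Set F) ⊆ primeTranslate (j * t)) →
        (∀ j ∈ J, ((A j).card : ℝ) ≤
          C₃ * max ((p : ℝ) ^ (1 / 2 : ℝ)) ((n : ℝ) ^ (2560 / 6419 : ℝ))) →
      ∀ L : Finset (AffineSubspace F (F × F)), (∀ l ∈ L, IsPlaneLine l) → L.card = n →
        (incidences P L : ℝ) ≤ K * (n : ℝ) ^ (3 / 2 - 1 / 12838 : ℝ) := by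
  -- Once q ≥ Q, each of C₁² and 2|C₂| + |C₃| costs at most one factor q.
  set Q : ℝ := 2 ^ 11 + C₁ ^ 2 + (2 * |C₂| + |C₃|) with hQ
  have hQ1 : 2 ^ 11 ≤ Q := by rw [hQ, add_assoc]; exact le_add_of_nonneg_right (by positivity)
  have hQ2 : C₁ ^ 2 ≤ Q := by
    have : 0 ≤ 2 * |C₂| + |C₃| := by positivity
    linarith
  have hQ3 : 2 * |C₂| + |C₃| ≤ Q := by
    have : 0 ≤ C₁ ^ 2 := by positivity
    linarith
  clear_value Q
  -- The summand Q^25676 covers q < Q, where the trivial bound n² = q^25676 suffices.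
  refine ⟨16 + Q ^ 25676, ?_⟩
  intro p hp F _ _ hF t ht n P hPn hxP J A hJ hA hJc hAt hAc L hline hLn
  have : Fact p.Prime := ⟨hp⟩
  have : CharP F p := by
    have := Fintype.ofFinite F
    exact charP_of_card_eq_prime_pow (f := 2) (by rw [← Nat.card_eq_fintype_card, hF])
  have hQ0 : 0 ≤ Q := by linarith
  -- This root makes the exponents integral: 3/2 - 1/12838 becomes 19256 and 2560/6419 becomes 5120.
  set q : ℝ := (n : ℝ) ^ (1 / 12838 : ℝ) with hqdef
  have hn0 : (0 : ℝ) ≤ n := Nat.cast_nonneg n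
  have hqn : q ^ 12838 = n := by
    rw [hqdef, ← Real.rpow_natCast, ← Real.rpow_mul hn0]
    norm_num
  have hqI : (n : ℝ) ^ (3 / 2 - 1 / 12838 : ℝ) = q ^ 19256 := by
    rw [hqdef, ← Real.rpow_natCast, ← Real.rpow_mul hn0]
    norm_num
  have hqA : (n : ℝ) ^ (2560 / 6419 : ℝ) = q ^ 5120 := by
    rw [hqdef, ← Real.rpow_natCast, ← Real.rpow_mul hn0]
    norm_num
  rw [hqI]
  rw [hqA] at hJc hAc
  have htriv : (incidences P L : ℝ) ≤ n * n := by
    have := incidences_le P L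
    rw [hPn, hLn] at this
    exact_mod_cast this
  rcases Nat.eq_zero_or_pos n with rfl | hnpos
  · refine htriv.trans ?_
    simp only [Nat.cast_zero, mul_zero]
    exact mul_nonneg (add_nonneg (by norm_num) (pow_nonneg hQ0 _))
      (pow_nonneg (Real.rpow_nonneg hn0 _) _)
  have hq1 : 1 ≤ q := Real.one_le_rpow (by exact_mod_cast hnpos) (by norm_num)
  have hq0 : 0 < q := by linarith
  clear_value q
  rcases lt_or_ge q Q with hqQ | hqQ
  · have h1 : 1 ≤ q ^ 19256 := one_le_pow₀ hq1
    have h2 : (incidences P L : ℝ) ≤ Q ^ 25676 :=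
      calc (incidences P L : ℝ) ≤ n * n := htriv
        _ = q ^ 25676 := by rw [← hqn, ← pow_add]
        _ ≤ Q ^ 25676 := pow_le_pow_left₀ hq0.le hqQ.le _
    have h3 : 0 ≤ Q ^ 25676 := pow_nonneg hQ0 _
    generalize Q ^ 25676 = y at h2 h3 ⊢
    generalize q ^ 19256 = z at h1 ⊢
    nlinarith
  by_contra! hcon
  have hI : 16 * q ^ 19256 < incidences P L := by
    refine lt_of_le_of_lt ?_ hcon
    gcongr
    have : 0 ≤ Q ^ 25676 := by positivity
    linarith
  obtain ⟨D, hDx, hDc, hD⟩ := exists_mobius_mem_bot_of_incidences (p := p) (hQ1.trans hqQ)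
    (by rw [hPn, hqn]) (by rw [hLn, hqn]) hline hI
  have hlt : ∀ i j : ℕ, i < j → q ^ i < q ^ j := fun i j hij =>
    pow_lt_pow_right₀ (by linarith) hij
  rcases hD with hp2 | ⟨hp1, D', hD'D, hD'c, r, s, b, hrs, hb, hz⟩
  -- Squaring q^6418 ≤ |D| ≤ |A| ≤ C₁ p contradicts p² ≤ q^11272.
  · have h1 : q ^ 6418 ≤ C₁ * p :=
      hDc.trans (le_trans (by exact_mod_cast Finset.card_le_card hDx) hxP)
    have h2 : q ^ 12836 ≤ q ^ 11273 :=
      calc q ^ 12836 = (q ^ 6418) ^ 2 := by ring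
        _ ≤ (C₁ * p) ^ 2 := by gcongr
        _ = C₁ ^ 2 * (p : ℝ) ^ 2 := by ring
        _ ≤ q * q ^ 11272 := by
          gcongr
          exact hQ2.trans hqQ
        _ = q ^ 11273 := by ring
    linarith [hlt 11273 12836 (by norm_num)]
  · classical
    set w : ℝ := (p : ℝ) ^ (1 / 2 : ℝ) with hw
    have hw2 : w ^ 2 = p := by
      rw [hw, ← Real.rpow_natCast, ← Real.rpow_mul (Nat.cast_nonneg p)]
      norm_num
    have hw0 : 0 ≤ w := Real.rpow_nonneg (Nat.cast_nonneg p) _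
    have hmx : 0 ≤ max w (q ^ 5120) := le_max_of_le_left hw0
    have h1 := card_le_of_mobius_mem_bot (p := p) (ht.notMem_bot hF) hJ hAt
      (N := |C₃| * max w (q ^ 5120)) (by positivity)
      (fun j hj => (hAc j hj).trans (by gcongr; exact le_abs_self _)) (D := D')
      (fun a ha => by
        have h2 : a ∈ (xProj P : Set F) := hDx (hD'D ha)
        rw [hA] at h2
        simpa using h2) hrs hb hz
    have h2 : (J.card : ℝ) ≤ |C₂| * max w (q ^ 5120) :=
      hJc.trans (by gcongr; exact le_abs_self _)
    have h3 : q ^ 6361 ≤ q * max w (q ^ 5120) :=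
      calc q ^ 6361 ≤ (2 * |C₂| + |C₃|) * max w (q ^ 5120) := by linarith
        _ ≤ q * max w (q ^ 5120) := by
          gcongr
          exact hQ3.trans hqQ
    -- If p^(1/2) is the maximum, square and use p ≤ q^11272; otherwise compare q^6361 with q^5121
    -- directly.
    rcases max_cases w (q ^ 5120) with ⟨h4, -⟩ | ⟨h4, -⟩
    · rw [h4] at h3
      have h5 : q ^ 12722 ≤ q ^ 11274 :=
        calc q ^ 12722 = (q ^ 6361) ^ 2 := by ring
          _ ≤ (q * w) ^ 2 := by gcongr
          _ = q ^ 2 * p := by rw [mul_pow, hw2]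
          _ ≤ q ^ 2 * q ^ 11272 := by gcongr
          _ = q ^ 11274 := by ring
      linarith [hlt 11274 12722 (by norm_num)]
    · rw [h4] at h3
      have h5 : q * q ^ 5120 = q ^ 5121 := by ring
      linarith [hlt 5121 6361 (by norm_num)]
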